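/- Let $P\subset\mathbb R^n$ be a simple polytope of dimension $n$ with facets $F_1,\dots,F_m$, where $F_i=P\cap\{h_i=0\}$ and $P=\{h_1\ge 0,\dots,h_m\ge 0\}$ for affine functions $h_i$. Let $N$ be a free $\mathbb Z$-module of rank $n$, and let $\lambda_1,\dots,\lambda_m\in N$ be such that $\lambda_{i_1},\dots,\lambda_{i_k}$ are linearly independent over $\mathbb Z$ whenever $F_{i_1}\cap\dots\cap F_{i_k}\neq\emptyset$. For a free $\mathbb Z$-module $L$ of finite rank put $L_{\mathbb R}=L\otimes\mathbb R$ and $T_L=L_{\mathbb R}/L$; a homomorphism $L\to L'$ induces a homomorphism $T_L\to T_{L'}$. For a face $F$ of $P$ let $N(F)\subseteq N$ be the submodule generated by the $\lambda_i$ with $F\subseteq F_i$. The quasitoric orbifold $\mathbf X$ of the model $(P,N,\{\lambda_i\})$ has underlying space $X=P\times T_N/\!\sim$, where $(p,t)\sim(q,s)$ if $p=q$ and $t-s$ lies in the image of $T_{N(F)}\to T_N$, $F$ being the face whose relative interior contains $p$. The torus $T_N$ acts on $X$ by translation in the second factor. The orbifold atlas of $\mathbf X$ has the following charts. For a vertex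 $v$ lying on the facets $F_{i_1},\dots,F_{i_n}$, let $U_v$ be the complement in $P$ of all facets not containing $v$, and let $W_v\subset\mathbb C^n$ be the set of all $\bigl(\sqrt{h_{i_k}(p)}\,e^{2\pi i a_k}\bigr)_{k}$ with $p\in U_v$, $a\in\mathbb R^n$; the chart map sends this point to $\bigl[p,\sum_k a_k\lambda_{i_k}\bigr]$, and the chart group is $G_v=N/N(v)$, the class of $\sum_k b_k\lambda_{i_k}\in N$ $(b_k\in\mathbb R)$ acting on $W_v$ by $z_k\mapsto e^{2\pi i b_k}z_k$. Let $\widehat N\subseteq N$ be the submodule generated by $\lambda_1,\dots,\lambda_m$, let $\widehat\lambda_i$ be $\lambda_i$ regarded as an element of $\widehat N$, and let $\mathbf O$ be the quasitoric orbifold of the model $(P,\widehat N,\{\widehat\lambda_i\})$. Let $\iota_*:T_{\widehat N}\to T_N$ be induced by the inclusion $\widehat N\subseteq N$, and let $f:O\to X$, $f([p,t])=[p,\iota_*t]$. An orbifold is a Hausdorff paracompact space with an atlas of compatible charts $(V,\Gamma,\varphi)$, with $V$ connected and open in $\mathbb C^n$ and $\Gamma$ a finite group of diffeomorphisms of $V$;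 a map of orbifolds is smooth if it is continuous and lifts locally to smooth maps between charts. An orbifold covering is a smooth map of orbifolds $p:\mathbf Y\to\mathbf Z$ such that every point of $Z$ lies in the image $U\cong V/\Gamma$ of an orbifold chart $(V,\Gamma,\varphi)$ for which each connected component $W$ of $p^{-1}(U)$ is the image $W\cong V/\Gamma'$ of an orbifold chart $(V,\Gamma',\varphi')$ of $\mathbf Y$ with $\Gamma'\le\Gamma$ and $p\circ\varphi'=\varphi$. A deck transformation of $p$ is an orbifold diffeomorphism $h$ of $\mathbf Y$ with $p\circ h=p$. **Proposition.** The charts above make $\mathbf X$ and $\mathbf O$ orbifolds, and $f:\mathbf O\to\mathbf X$ is a surjective orbifold covering with $f(t\cdot x)=\iota_*(t)\cdot f(x)$ for all $t\in T_{\widehat N}$, $x\in O$. The deck transformations of $f$ form a group isomorphic to $N/\widehat N$; explicitly, the class of $\nu\in N$ corresponds to the translation $x\mapsto[\nu]\cdot x$, where $[\nu]\in\ker\iota_*\subset T_{\widehat N}$ is the class of $\nu\in N\subset N_{\mathbb R}=\widehat N_{\mathbb R}$. -/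

import Mathlib

open scoped TensorProduct ContDiff

noncomputable section

/-! ### Effective orbifolds, their smooth maps and their coverings

Orbifolds are modelled on a real normed space `E` (for a `d`-dimensional orbifold, `E` is
`d`-dimensional) and are given by orbifold atlases on a topological space. -/

/-- A map between subsets of `E` is smooth if it is given by a function that is `C^∞` on the
source. It is used for open sources only. -/
def IsSmoothMap {E : Type*} [NormedAddCommGroup E] [NormedSpace ℝ E] {D D' : Set E}
    (g : D → D') : Prop :=
  ∃ G : E → E, ContDiffOn ℝ ∞ G D ∧ ∀ x : D, (g x : E) = G x

/-- The data `(Ũ, G, φ)` of an orbifold chart on `X`: a subset `Ũ` of `E`, a group `G` of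
transformations of `Ũ`, and a map `φ : Ũ → X`. -/
structure OrbifoldChartData (E : Type*) (X : Type*) where
  domain : Set E
  group : Subgroup (Equiv.Perm domain)
  toFun : domain → X

namespace OrbifoldChartData

variable {E : Type*} [NormedAddCommGroup E] [NormedSpace ℝ E] {X : Type*} [TopologicalSpace X]

/-- `(Ũ, G, φ)` is an orbifold chart: `Ũ` is open and connected, `G` is a finite group of
diffeomorphisms of `Ũ`, and `φ` is a continuous open map that induces a bijection (hence a
homeomorphism) from `Ũ / G` onto `φ(Ũ)`. -/
structure IsOrbifoldChart (c : OrbifoldChartData E X) : Prop where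
  isOpen_domain : IsOpen c.domain
  isConnected_domain : IsConnected c.domain
  finite_group : Finite c.group
  smooth_group : ∀ g ∈ c.group, IsSmoothMap (g : c.domain → c.domain)
  continuous_toFun : Continuous c.toFun
  isOpenMap_toFun : IsOpenMap c.toFun
  eq_iff : ∀ x y : c.domain, c.toFun x = c.toFun y ↔ ∃ g ∈ c.group, g x = y

/-- Two orbifold charts are compatible if any two points of their domains lying over the same
point of `X` correspond to each other under a diffeomorphism, between open neighbourhoods of the two
points, that commutes with the projections to `X`. -/
def Compatible (c d : OrbifoldChartData E X) : Prop :=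
  ∀ (x : c.domain) (y : d.domain), c.toFun x = d.toFun y →
    ∃ h : OpenPartialHomeomorph E E,
      (x : E) ∈ h.source ∧ h x = y ∧ h.source ⊆ c.domain ∧ h.target ⊆ d.domain ∧
      ContDiffOn ℝ ∞ h h.source ∧ ContDiffOn ℝ ∞ h.symm h.target ∧
      ∀ (w : c.domain) (w' : d.domain), (w : E) ∈ h.source → (w' : E) = h w →
        d.toFun w' = c.toFun w

end OrbifoldChartData

section Orbifold

variable {E : Type*} [NormedAddCommGroup E] [NormedSpace ℝ E]
  {X : Type*} [TopologicalSpace X] {Y : Type*} [TopologicalSpace Y]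

/-- `A` is an orbifold atlas on `X`, that is, `(X, A)` is an (effective) orbifold. -/
structure IsOrbifoldAtlas (A : Set (OrbifoldChartData E X)) : Prop where
  t2Space : T2Space X
  paracompactSpace : ParacompactSpace X
  isOrbifoldChart : ∀ c ∈ A, c.IsOrbifoldChart
  compatible : ∀ c ∈ A, ∀ d ∈ A, c.Compatible d
  exists_chart : ∀ x : X, ∃ c ∈ A, x ∈ Set.range c.toFun

/-- The maximal atlas generated by `A`: all orbifold charts compatible with the charts in `A`. -/
def maximalOrbifoldAtlas (A : Set (OrbifoldChartData E X)) : Set (OrbifoldChartData E X) :=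
  {c | c.IsOrbifoldChart ∧ ∀ d ∈ A, c.Compatible d ∧ d.Compatible c}

/-- A smooth map of orbifolds `(Y, B) → (X, A)`: a continuous map that lifts, around every point, to
a smooth map between orbifold charts. -/
def IsOrbifoldSmooth (B : Set (OrbifoldChartData E Y)) (A : Set (OrbifoldChartData E X))
    (f : Y → X) : Prop :=
  Continuous f ∧ ∀ y : Y,
    ∃ c ∈ maximalOrbifoldAtlas B, ∃ d ∈ maximalOrbifoldAtlas A,
      y ∈ Set.range c.toFun ∧ f y ∈ Set.range d.toFun ∧
      ∃ F : c.domain → d.domain, IsSmoothMap F ∧ ∀ x, d.toFun (F x) = f (c.toFun x)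

/-- An orbifold covering `p : (Y, B) → (X, A)`: a smooth map of orbifolds such that every point of
`X` lies in the image `U ≅ V / Γ` of an orbifold chart `(V, Γ, φ)` for which each connected
component `W` of `p ⁻¹ U` is the image `W ≅ V / Γ'` of an orbifold chart `(V, Γ', φ')` of `Y` with
`Γ'` a subgroup of `Γ`, in such a way that `p : W → U` corresponds to the natural map
`V / Γ' → V / Γ`. -/
structure IsOrbifoldCovering (B : Set (OrbifoldChartData E Y)) (A : Set (OrbifoldChartData E X))
    (p : Y → X) : Prop where
  smooth : IsOrbifoldSmooth B A p
  locally_quotient : ∀ z : X, ∃ c ∈ maximalOrbifoldAtlas A, z ∈ Set.range c.toFun ∧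
    ∀ y ∈ p ⁻¹' Set.range c.toFun,
      ∃ (Γ' : Subgroup (Equiv.Perm c.domain)) (φ' : c.domain → Y),
        Γ' ≤ c.group ∧
        (⟨c.domain, Γ', φ'⟩ : OrbifoldChartData E Y) ∈ maximalOrbifoldAtlas B ∧
        Set.range φ' = connectedComponentIn (p ⁻¹' Set.range c.toFun) y ∧
        ∀ x, p (φ' x) = c.toFun x

/-- A deck transformation of `p : (Y, B) → (X, A)`: a diffeomorphism `h` of the orbifold `(Y, B)`
such that `p ∘ h = p`. -/
def IsDeckTransformation (B : Set (OrbifoldChartData E Y)) (p : Y → X) (h : Y ≃ₜ Y) : Prop :=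
  IsOrbifoldSmooth B B h ∧ IsOrbifoldSmooth B B h.symm ∧ p ∘ h = p

end Orbifold

/-! ### The torus of a free `ℤ`-module -/

/-- `N_ℝ = N ⊗ ℝ`. -/
def RealExt (N : Type*) [AddCommGroup N] : Type _ := ℝ ⊗[ℤ] N

section Torus

variable (N : Type*) [AddCommGroup N]

instance : AddCommGroup (RealExt N) := inferInstanceAs (AddCommGroup (ℝ ⊗[ℤ] N))

instance : Module ℝ (RealExt N) := inferInstanceAs (Module ℝ (ℝ ⊗[ℤ] N))

/-- For `N` finitely generated, this is the usual topology of a finite-dimensional real vector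
space. -/
instance : TopologicalSpace (RealExt N) := moduleTopology ℝ (RealExt N)

instance : IsModuleTopology ℝ (RealExt N) := ⟨rfl⟩

variable {N} in
/-- The element `a ⊗ x` of `N_ℝ`. -/
def RealExt.tmul (a : ℝ) (x : N) : RealExt N := a ⊗ₜ[ℤ] x

/-- The natural map `N → N_ℝ`. -/
def RealExt.incl : N →+ RealExt N :=
  (TensorProduct.mk ℤ ℝ N 1).toAddMonoidHom

/-- The homomorphism `N_ℝ → N'_ℝ` induced by a homomorphism `N → N'`. -/
def RealExt.map {N N' : Type*} [AddCommGroup N] [AddCommGroup N'] (g : N →ₗ[ℤ] N') :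
    RealExt N →+ RealExt N' :=
  (TensorProduct.map (LinearMap.id : ℝ →ₗ[ℤ] ℝ) g).toAddMonoidHom

/-- The torus `T_N = N_ℝ / N`, written additively, with the quotient topology. -/
abbrev Torus : Type _ := RealExt N ⧸ (RealExt.incl N).range

/-- The quotient map `N_ℝ → T_N`. -/
abbrev Torus.mk : RealExt N →+ Torus N := QuotientAddGroup.mk' _

theorem RealExt.map_incl {N N' : Type*} [AddCommGroup N] [AddCommGroup N'] (g : N →ₗ[ℤ] N')
    (x : N) : RealExt.map g (RealExt.incl N x) = RealExt.incl N' (g x) :=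
  TensorProduct.map_tmul _ _ _ _

/-- The homomorphism `T_N → T_N'` induced by a homomorphism `N → N'`. For the inclusion of a
submodule `M` of `N`, it is `ξ_M : T_M → T_N`. -/
def Torus.map {N N' : Type*} [AddCommGroup N] [AddCommGroup N'] (g : N →ₗ[ℤ] N') :
    Torus N →+ Torus N' :=
  QuotientAddGroup.map _ _ (RealExt.map g) (by
    rintro _ ⟨x, rfl⟩
    exact ⟨g x, (RealExt.map_incl g x).symm⟩)

theorem Torus.map_map {N N' N'' : Type*} [AddCommGroup N] [AddCommGroup N'] [AddCommGroup N'']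
    (g : N →ₗ[ℤ] N') (g' : N' →ₗ[ℤ] N'') (t : Torus N) :
    Torus.map g' (Torus.map g t) = Torus.map (g' ∘ₗ g) t := by
  obtain ⟨a, rfl⟩ := QuotientAddGroup.mk_surjective t
  change Torus.mk N'' (RealExt.map g' (RealExt.map g a)) = Torus.mk N'' (RealExt.map (g' ∘ₗ g) a)
  congr 1
  change TensorProduct.map (LinearMap.id : ℝ →ₗ[ℤ] ℝ) g'
    (TensorProduct.map (LinearMap.id : ℝ →ₗ[ℤ] ℝ) g a) =
      TensorProduct.map (LinearMap.id : ℝ →ₗ[ℤ] ℝ) (g' ∘ₗ g) a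
  have h := TensorProduct.map_comp (LinearMap.id : ℝ →ₗ[ℤ] ℝ) g' (LinearMap.id : ℝ →ₗ[ℤ] ℝ) g
  rw [LinearMap.id_comp] at h
  rw [h]
  rfl

end Torus

/-! ### Simple polytopes -/

/-- A simple polytope of dimension `n` with `m` facets, given as a bounded intersection of closed
half-spaces `{x | 0 ≤ ineq i x}` in `ℝⁿ`, one for each facet. -/
structure SimplePolytope (n m : ℕ) where
  /-- The affine functions whose non-negativity defines the polytope. -/
  ineq : Fin m → (EuclideanSpace ℝ (Fin n) →ᵃ[ℝ] ℝ)
  isBounded : Bornology.IsBounded {x | ∀ i, 0 ≤ ineq i x}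
  interior_nonempty : (interior {x | ∀ i, 0 ≤ ineq i x}).Nonempty
  /-- The sets `F_i` are faces of dimension `n - 1`. -/
  facet_nonempty : ∀ i, {x | (∀ j, 0 ≤ ineq j x) ∧ ineq i x = 0}.Nonempty
  finrank_facet : ∀ i,
    Module.finrank ℝ (vectorSpan ℝ {x | (∀ j, 0 ≤ ineq j x) ∧ ineq i x = 0}) + 1 = n
  /-- The facets `F_i` are pairwise distinct. -/
  facet_injective :
    Function.Injective fun i : Fin m => {x | (∀ j, 0 ≤ ineq j x) ∧ ineq i x = 0}
  /-- Simplicity: every vertex lies on exactly `n` facets. -/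
  simple : ∀ v ∈ Set.extremePoints ℝ {x | ∀ i, 0 ≤ ineq i x}, {i | ineq i v = 0}.ncard = n

namespace SimplePolytope

variable {n m : ℕ} (P : SimplePolytope n m)

/-- The underlying set of the polytope. -/
def carrier : Set (EuclideanSpace ℝ (Fin n)) := {x | ∀ i, 0 ≤ P.ineq i x}

/-- The facet `F_i`. -/
def facet (i : Fin m) : Set (EuclideanSpace ℝ (Fin n)) := {x ∈ P.carrier | P.ineq i x = 0}

/-- The vertices of the polytope. -/
def vertices : Set (EuclideanSpace ℝ (Fin n)) := Set.extremePoints ℝ P.carrier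

/-- The set of indices of the facets containing `p`. For `p` in `P` it is `I(F)`, where `F` is the
unique face of `P` whose relative interior contains `p`, as `F` is the intersection of all facets
containing `p`; for a vertex `v` it is `I(v)`. -/
def facetsAt (p : EuclideanSpace ℝ (Fin n)) : Set (Fin m) := {i | p ∈ P.facet i}

/-- The open neighbourhood `U_v` of a vertex `v`: the complement in `P` of all facets that do not
contain `v`. -/
def vertexNhd (v : EuclideanSpace ℝ (Fin n)) : Set (EuclideanSpace ℝ (Fin n)) :=
  {p ∈ P.carrier | ∀ i, v ∉ P.facet i → p ∉ P.facet i}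

theorem vertices_nonempty : P.vertices.Nonempty := by
  refine IsCompact.extremePoints_nonempty (Metric.isCompact_of_isClosed_isBounded ?_ P.isBounded)
    (P.interior_nonempty.mono interior_subset)
  have h : P.carrier = ⋂ i, {x | 0 ≤ P.ineq i x} := by
    ext x
    simp [carrier]
  rw [h]
  exact isClosed_iInter fun i =>
    isClosed_le continuous_const (P.ineq i).continuous_of_finiteDimensional

theorem ncard_facetsAt {v : EuclideanSpace ℝ (Fin n)} (hv : v ∈ P.vertices) :
    (P.facetsAt v).ncard = n := by
  refine Eq.trans (congrArg Set.ncard ?_) (P.simple v hv)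
  ext i
  exact ⟨fun h => h.2, fun h => ⟨extremePoints_subset hv, h⟩⟩

end SimplePolytope

/-! ### Combinatorial models and quasitoric orbifolds -/

/-- A combinatorial model `(P, N, {λ_i})`: `N` is a free `ℤ`-module of rank `n = dim P` and
`λ_i ∈ N` are vectors, one for each facet, such that the vectors of any set of facets with non-empty
intersection are linearly independent over `ℤ`. -/
structure CombinatorialModel {n m : ℕ} (P : SimplePolytope n m) (N : Type*) [AddCommGroup N] where
  free : Module.Free ℤ N
  finite : Module.Finite ℤ N
  finrank_eq : Module.finrank ℤ N = n
  /-- The characteristic vectors `λ_i`. -/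
  vec : Fin m → N
  linearIndependent : ∀ s : Set (Fin m), (∃ p ∈ P.carrier, ∀ i ∈ s, p ∈ P.facet i) →
    LinearIndependent ℤ fun i : s => vec i

namespace CombinatorialModel

variable {n m : ℕ} {P : SimplePolytope n m} {N : Type*} [AddCommGroup N]
  (M : CombinatorialModel P N)

/-- The submodule `N(F)` of `N` generated by the characteristic vectors of the facets containing
`F`, where `F` is the face of `P` whose relative interior contains `p`. -/
def faceModule (p : EuclideanSpace ℝ (Fin n)) : Submodule ℤ N :=
  Submodule.span ℤ (M.vec '' P.facetsAt p)

/-- The equivalence relation `∼` on `P × T_N`: `(p, t) ∼ (q, s)` if `p = q` and `t - s` belongs to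
the image of `ξ_{N(F)} : T_{N(F)} → T_N`, where `F` is the face whose relative interior contains
`p`. -/
def setoid : Setoid (P.carrier × Torus N) where
  r x y := x.1 = y.1 ∧ x.2 - y.2 ∈ (Torus.map (M.faceModule x.1).subtype).range
  iseqv :=
    { refl := fun x => ⟨rfl, by rw [sub_self]; exact zero_mem _⟩
      symm := by
        rintro ⟨p, t⟩ ⟨q, s⟩ ⟨h, h'⟩
        obtain rfl : p = q := h
        refine ⟨rfl, ?_⟩
        rw [← neg_sub]
        exact neg_mem h'
      trans := by
        rintro ⟨p, t⟩ ⟨q, s⟩ ⟨r, u⟩ ⟨h, h'⟩ ⟨k, k'⟩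
        obtain rfl : p = q := h
        obtain rfl : p = r := k
        refine ⟨rfl, ?_⟩
        have := add_mem h' k'
        rwa [sub_add_sub_cancel] at this }

/-- The underlying space `X = P × T_N / ∼` of the quasitoric orbifold associated to the model. -/
def Space : Type _ := Quotient M.setoid

/-- The quotient topology. -/
instance : TopologicalSpace M.Space :=
  inferInstanceAs (TopologicalSpace (Quotient M.setoid))

/-- The point `[p, t]` of `X`. -/
def point (p : P.carrier) (t : Torus N) : M.Space := Quotient.mk M.setoid (p, t)

/-- The action of `T_N` on `X`. -/
instance : AddAction (Torus N) M.Space where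
  vadd s := Quotient.map (fun x => (x.1, s + x.2)) (by
    rintro ⟨p, t⟩ ⟨q, u⟩ ⟨h, h'⟩
    refine ⟨h, ?_⟩
    change s + t - (s + u) ∈ _
    rw [add_sub_add_left_eq_sub]
    exact h')
  zero_vadd x := by
    induction x using Quotient.inductionOn with
    | h x => exact congrArg (Quotient.mk M.setoid) (Prod.ext rfl (zero_add x.2))
  add_vadd s s' x := by
    induction x using Quotient.inductionOn with
    | h x => exact congrArg (Quotient.mk M.setoid) (Prod.ext rfl (add_assoc s s' x.2))

/-- The domain, in `ℂⁿ`, of the orbifold chart at the vertex `v`, with respect to an enumeration `e`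
of the facets containing `v`. It is the image of `U_v × T_{N(v)}` under
`(p, ∑ₖ aₖ ⊗ λ_{e k}) ↦ (√(h_{e k}(p)) exp(2πi aₖ))ₖ`, where `h_j` is the affine function defining
the facet `F_j`; this map identifies the quotient `W_v` of `U_v × T_{N(v)}` with the domain and
defines the smooth structure of `W_v`. -/
def chartDomain (P : SimplePolytope n m) (v : EuclideanSpace ℝ (Fin n))
    (e : Fin n ≃ P.facetsAt v) : Set (Fin n → ℂ) :=
  {z | ∃ p ∈ P.vertexNhd v, ∀ k, ‖z k‖ ^ 2 = P.ineq (e k) p}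

/-- The point `p` of `U_v` corresponding to a point of the domain of the chart. -/
def chartBase {v : EuclideanSpace ℝ (Fin n)} {e : Fin n ≃ P.facetsAt v}
    (z : chartDomain P v e) : P.carrier :=
  ⟨z.2.choose, z.2.choose_spec.1.1⟩

/-- The group `G_v = N / N(v)`, the kernel of `ξ_{N(v)} : T_{N(v)} → T_N`, as a group of
transformations of `W_v`: the element `∑ₖ aₖ ⊗ λ_{e k}` of `T_{N(v)}` acts on the coordinates by
`zₖ ↦ exp(2πi aₖ) zₖ`, and it is in the kernel if and only if `∑ₖ aₖ ⊗ λ_{e k}` is zero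
in `T_N`. -/
def chartGroup {v : EuclideanSpace ℝ (Fin n)} (e : Fin n ≃ P.facetsAt v) :
    Subgroup (Equiv.Perm (chartDomain P v e)) where
  carrier := {g | ∃ a : Fin n → ℝ,
    Torus.mk N (∑ k, RealExt.tmul (a k) (M.vec (e k))) = 0 ∧
    ∀ (z : chartDomain P v e) (k : Fin n),
      (g z : Fin n → ℂ) k = Complex.exp (2 * Real.pi * Complex.I * a k) * (z : Fin n → ℂ) k}
  one_mem' := by
    refine ⟨0, ?_, fun z k => by simp⟩
    have : ∀ x : N, RealExt.tmul 0 x = 0 := fun x => TensorProduct.zero_tmul _ _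
    simp [this]
  mul_mem' := by
    rintro g g' ⟨a, ha, hg⟩ ⟨a', ha', hg'⟩
    refine ⟨a + a', ?_, fun z k => ?_⟩
    · have : ∀ (b c : ℝ) (x : N),
          RealExt.tmul (b + c) x = RealExt.tmul b x + RealExt.tmul c x :=
        fun b c x => TensorProduct.add_tmul _ _ _
      simp only [Pi.add_apply, this, Finset.sum_add_distrib, map_add] at ha ha' ⊢
      rw [ha, ha', add_zero]
    · rw [Equiv.Perm.mul_apply, hg, hg', ← mul_assoc, ← Complex.exp_add]
      congr 2
      push_cast [Pi.add_apply]
      ring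
  inv_mem' := by
    rintro g ⟨a, ha, hg⟩
    refine ⟨-a, ?_, fun z k => ?_⟩
    · have : ∀ (b : ℝ) (x : N), RealExt.tmul (-b) x = -RealExt.tmul b x :=
        fun b x => TensorProduct.neg_tmul _ _
      simp only [Pi.neg_apply, this, Finset.sum_neg_distrib, map_neg] at ha ⊢
      rw [ha, neg_zero]
    · have h := hg (g⁻¹ z) k
      rw [show g (g⁻¹ z) = z from g.apply_symm_apply z] at h
      rw [h, ← mul_assoc, ← Complex.exp_add]
      simp

/-- The orbifold chart `(W_v, G_v, ξ_v)`, where `ξ_v : W_v → X` is induced by the homomorphism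
`ξ_{N(v)} : T_{N(v)} → T_N`. A vanishing coordinate of `z` may be given any argument, as the
corresponding circle is collapsed. -/
def chart (v : EuclideanSpace ℝ (Fin n)) (e : Fin n ≃ P.facetsAt v) :
    OrbifoldChartData (Fin n → ℂ) M.Space where
  domain := chartDomain P v e
  group := M.chartGroup e
  toFun z := M.point (chartBase z) (Torus.mk N
    (∑ k, RealExt.tmul (Complex.arg ((z : Fin n → ℂ) k) / (2 * Real.pi)) (M.vec (e k))))

/-- The orbifold atlas on `X` consisting of the charts at the vertices of `P`. -/
def atlas : Set (OrbifoldChartData (Fin n → ℂ) M.Space) :=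
  {c | ∃ v ∈ P.vertices, ∃ e : Fin n ≃ P.facetsAt v, c = M.chart v e}

/-- The submodule `N̂` of `N` generated by all the characteristic vectors. -/
def hatModule : Submodule ℤ N := Submodule.span ℤ (Set.range M.vec)

/-- The combinatorial model `(P, N̂, {λ̂_i})`, where `λ̂_i` is `λ_i` as an element of `N̂`. -/
def hat : CombinatorialModel P M.hatModule where
  free := by
    have := M.free
    have := M.finite
    infer_instance
  finite := by
    have := M.finite
    infer_instance
  finrank_eq := by
    have := M.free
    have := M.finite
    apply le_antisymm
    · exact (Submodule.finrank_le M.hatModule).trans_eq M.finrank_eq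
    · obtain ⟨v, hv⟩ := P.vertices_nonempty
      have h1 := M.linearIndependent (P.facetsAt v) ⟨v, extremePoints_subset hv, fun i hi => hi⟩
      have h2 : LinearIndependent ℤ fun i : P.facetsAt v =>
          (⟨M.vec i, Submodule.subset_span ⟨i, rfl⟩⟩ : M.hatModule) :=
        LinearIndependent.of_comp M.hatModule.subtype h1
      have := Fintype.ofFinite (P.facetsAt v)
      have h3 := h2.fintype_card_le_finrank
      rwa [← Nat.card_eq_fintype_card, Nat.card_coe_set_eq, P.ncard_facetsAt hv] at h3
  vec i := ⟨M.vec i, Submodule.subset_span ⟨i, rfl⟩⟩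
  linearIndependent s hs :=
    LinearIndependent.of_comp M.hatModule.subtype (M.linearIndependent s hs)

/-- The map `f : O → X`, `[p, t] ↦ [p, ι_* t]`, where `O` is the space of the model
`(P, N̂, {λ̂_i})` and `ι_* : T_N̂ → T_N` is induced by the inclusion of `N̂` in `N`. -/
def coverMap : M.hat.Space → M.Space :=
  Quotient.map (fun x => (x.1, Torus.map M.hatModule.subtype x.2)) (by
    rintro ⟨p, t⟩ ⟨q, s⟩ ⟨h, u, hu⟩
    refine ⟨h, ?_⟩
    change Torus.map _ t - Torus.map _ s ∈ (Torus.map (M.faceModule p).subtype).range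
    rw [← map_sub]
    change Torus.map (M.hat.faceModule p).subtype u = t - s at hu
    rw [← hu, Torus.map_map]
    have hmem : ∀ x : M.hat.faceModule p, (x : N) ∈ M.faceModule p := by
      intro x
      have hx : M.hatModule.subtype x ∈ (M.hat.faceModule p).map M.hatModule.subtype :=
        ⟨x, x.2, rfl⟩
      have h' : (M.hat.faceModule p).map M.hatModule.subtype = M.faceModule p := by
        unfold faceModule
        rw [Submodule.map_span, ← Set.image_comp]
        rfl
      rw [h'] at hx
      exact hx
    refine ⟨Torus.map ((M.hatModule.subtype ∘ₗ (M.hat.faceModule p).subtype).codRestrict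
      (M.faceModule p) hmem) u, ?_⟩
    rw [Torus.map_map]
    rfl)

end CombinatorialModel

end

/-! At a vertex `v` the functions `h_i` of the `n` facets through `v` are affine coordinates on
`ℝⁿ`, and their vectors `λ_i` form a basis of `N_ℝ`. Polar coordinates `z_k = √h_k · exp(2πi a_k)`
then carry the part of `P × N_ℝ` over `U_v` onto `W_v`. Two elements over the same `p` define the
same point of `X` exactly when they differ by a lattice vector and a real combination of the `λ_i`
with `p ∈ F_i` (`point_eq_point_iff`). The combination only changes arguments of vanishing
coordinates, and the lattice vector acts through `G_v`; so `X` over `U_v` is `W_v / G_v`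
(`point_frame_eq_iff`, `isOrbifoldChart_chart`).

Near a point over `p`, a change of vertex is, once a lattice vector is fixed, affine in the
arguments. Facets through `p` contain both vertices, and their coordinates are only multiplied by
phases depending on the other arguments. All other coordinates are nonzero there, so branches of the
argument and square roots are smooth (`compatible_chart`).

Since `N̂` has finite index in `N`, the inclusion becomes an isomorphism over `ℝ`. The charts of `O`
and `X` at `v` have the same domain, `f` lifts to the identity, and only the group grows, from `N̂ /
N(v)` to `N / N(v)` (`isOrbifoldCovering_coverMap`).

Over the interior of `P` no circle is collapsed, so the torus acts freely and the fibres of `f` are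
orbits of `N / N̂`. A deck transformation moves each such point by a unique element of this finite
group; the element is locally constant, hence constant by connectedness, and density with the
Hausdorff property extends the identity to all of `O` (`exists_deck_eq`). -/

noncomputable section

/-! ### Vertices, interior and facet coordinates of a simple polytope. -/

namespace SimplePolytope

variable {n m : ℕ} (P : SimplePolytope n m)

theorem mem_facetsAt {p : EuclideanSpace ℝ (Fin n)} (hp : p ∈ P.carrier) {i : Fin m} :
    i ∈ P.facetsAt p ↔ P.ineq i p = 0 :=
  ⟨fun h => h.2, fun h => ⟨hp, h⟩⟩

theorem mem_vertexNhd_iff {v p : EuclideanSpace ℝ (Fin n)} :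
    p ∈ P.vertexNhd v ↔ p ∈ P.carrier ∧ P.facetsAt p ⊆ P.facetsAt v :=
  and_congr_right fun _ => forall_congr' fun _ => not_imp_not

theorem continuous_ineq (i : Fin m) : Continuous (P.ineq i) :=
  (P.ineq i).continuous_of_finiteDimensional

theorem ineq_lineMap (i : Fin m) (p q : EuclideanSpace ℝ (Fin n)) (t : ℝ) :
    P.ineq i (AffineMap.lineMap p q t) = (1 - t) * P.ineq i p + t * P.ineq i q := by
  rw [AffineMap.apply_lineMap, AffineMap.lineMap_apply_module]
  simp

theorem ineq_add (i : Fin m) (p d : EuclideanSpace ℝ (Fin n)) :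
    P.ineq i (d + p) = (P.ineq i).linear d + P.ineq i p :=
  (P.ineq i).map_vadd p d

theorem isClosed_carrier : IsClosed P.carrier := by
  rw [show P.carrier = ⋂ i, {x | 0 ≤ P.ineq i x} by ext x; simp [carrier]]
  exact isClosed_iInter fun i => isClosed_le continuous_const (P.continuous_ineq i)

theorem isCompact_carrier : IsCompact P.carrier :=
  Metric.isCompact_of_isClosed_isBounded P.isClosed_carrier P.isBounded

/-- The defining affine functions of the facets through a vertex have independent linear parts. -/
theorem eq_zero_of_linear_eq_zero {v : EuclideanSpace ℝ (Fin n)} (hv : v ∈ P.vertices)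
    {d : EuclideanSpace ℝ (Fin n)} (hd : ∀ i ∈ P.facetsAt v, (P.ineq i).linear d = 0) : d = 0 := by
  have hvP : v ∈ P.carrier := extremePoints_subset hv
  -- Moving along `d` keeps the functions of the facets through `v` at zero and, for small `t`, the
  -- others positive. So `v` is the midpoint of a segment in `P`, which extremality forces to be a
  -- point.
  have key : ∀ᶠ t : ℝ in nhds 0, ∀ i, 0 ≤ P.ineq i (t • d + v) := by
    rw [Filter.eventually_all]
    intro i
    by_cases hi : i ∈ P.facetsAt v
    · refine Filter.Eventually.of_forall fun t => ?_
      rw [ineq_add, map_smul, hd i hi, hi.2]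
      simp
    · have h0 : 0 < P.ineq i v :=
        lt_of_le_of_ne (hvP i) fun h => hi ((P.mem_facetsAt hvP).2 h.symm)
      have hc : Continuous fun t : ℝ => P.ineq i (t • d + v) :=
        (P.continuous_ineq i).comp (by fun_prop)
      have := (hc.tendsto 0).eventually (lt_mem_nhds (a := (0 : ℝ)) (by simpa using h0))
      exact this.mono fun t ht => ht.le
  obtain ⟨ε, hε, h⟩ := Metric.eventually_nhds_iff.1 key
  have h1 : (ε / 2) • d + v ∈ P.carrier := h (by
    rw [Real.dist_eq, sub_zero, abs_of_pos (half_pos hε)]; linarith)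
  have h2 : (-(ε / 2)) • d + v ∈ P.carrier := h (by
    rw [Real.dist_eq, sub_zero, abs_neg, abs_of_pos (half_pos hε)]; linarith)
  have h3 : v ∈ openSegment ℝ ((ε / 2) • d + v) ((-(ε / 2)) • d + v) := by
    refine ⟨1 / 2, 1 / 2, by norm_num, by norm_num, by norm_num, ?_⟩
    module
  have h4 := (mem_extremePoints.1 hv).2 _ h1 _ h2 h3
  have h5 : (ε / 2) • d = 0 := by simpa using h4.1
  exact (smul_eq_zero.1 h5).resolve_left (half_pos hε).ne'

/-- The smallest face containing `p` is compact, so it has an extreme point. A face is an extreme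
subset, hence this point is a vertex of `P`, and it lies on every facet through `p`. -/
theorem exists_mem_vertexNhd {p : EuclideanSpace ℝ (Fin n)} (hp : p ∈ P.carrier) :
    ∃ v ∈ P.vertices, p ∈ P.vertexNhd v := by
  let F : Set (EuclideanSpace ℝ (Fin n)) := {x ∈ P.carrier | ∀ i ∈ P.facetsAt p, P.ineq i x = 0}
  have hF : IsClosed F := by
    rw [show F = P.carrier ∩ ⋂ i ∈ P.facetsAt p, {x | P.ineq i x = 0} by ext x; simp [F]]
    exact P.isClosed_carrier.inter (isClosed_biInter fun i _ =>
      isClosed_eq (P.continuous_ineq i) continuous_const)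
  have hFc : IsCompact F := P.isCompact_carrier.of_isClosed_subset hF fun x hx => hx.1
  obtain ⟨v, hv⟩ := hFc.extremePoints_nonempty (⟨p, hp, fun i hi => hi.2⟩ : F.Nonempty)
  have hext : IsExtreme ℝ P.carrier F := by
    refine ⟨fun x hx => hx.1, fun x hx y hy z hz hzxy => ⟨hx, fun i hi => ?_⟩⟩
    obtain ⟨a, b, ha, hb, hab, rfl⟩ := hzxy
    have h := hz.2 i hi
    have hb' : a = 1 - b := by linarith
    rw [hb', ← AffineMap.lineMap_apply_module, ineq_lineMap, ← hb'] at h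
    have hx0 := hx i
    have hy0 := mul_nonneg hb.le (hy i)
    have := mul_nonneg ha.le hx0
    have h0 : a * P.ineq i x = 0 := by linarith
    exact (mul_eq_zero.1 h0).resolve_left ha.ne'
  refine ⟨v, hext.extremePoints_subset_extremePoints hv, P.mem_vertexNhd_iff.2 ⟨hp, fun i hi => ?_⟩⟩
  exact ⟨hv.1.1, hv.1.2 i hi⟩

/-- The interior of the polytope. -/
def inner : Set (EuclideanSpace ℝ (Fin n)) := {p | ∀ i, 0 < P.ineq i p}

theorem inner_subset : P.inner ⊆ P.carrier := fun _ h i => (h i).le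

theorem facetsAt_eq_empty {p : EuclideanSpace ℝ (Fin n)} (hp : p ∈ P.inner) :
    P.facetsAt p = ∅ :=
  Set.eq_empty_of_forall_notMem fun i hi => (hp i).ne' hi.2

/-- An affine function vanishing at an interior point of `P` has a local minimum there, so it is
identically zero. Its facet would then be all of `P`, of dimension `n` instead of `n - 1`. -/
theorem inner_nonempty : P.inner.Nonempty := by
  obtain ⟨x, hx⟩ := P.interior_nonempty
  refine ⟨x, fun i => lt_of_le_of_ne (interior_subset hx i) fun h0 => ?_⟩
  have hloc : IsLocalMin (P.ineq i) x := by
    filter_upwards [mem_interior_iff_mem_nhds.1 hx] with y hy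
    rw [← h0]
    exact hy i
  have hlin : (P.ineq i).linear = 0 := by
    ext d
    have hc : Continuous fun t : ℝ => t • d + x := by fun_prop
    have h1 : ∀ᶠ t : ℝ in nhds 0, P.ineq i x ≤ P.ineq i (t • d + x) := by
      have := hc.tendsto 0
      rw [zero_smul, zero_add] at this
      exact this.eventually hloc
    obtain ⟨ε, hε, h⟩ := Metric.eventually_nhds_iff.1 h1
    have h2 := h (y := ε / 2) (by rw [Real.dist_eq, sub_zero, abs_of_pos (half_pos hε)]; linarith)
    have h3 := h (y := -(ε / 2)) (by
      rw [Real.dist_eq, sub_zero, abs_neg, abs_of_pos (half_pos hε)]; linarith)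
    rw [ineq_add, map_smul, smul_eq_mul, ← h0] at h2 h3
    simp only [LinearMap.zero_apply]
    nlinarith
  have hzero : ∀ y, P.ineq i y = 0 := fun y => by
    have := P.ineq_add i x (y - x)
    rw [sub_add_cancel, hlin, ← h0] at this
    simpa using this
  have hset : {x | (∀ j, 0 ≤ P.ineq j x) ∧ P.ineq i x = 0} = {x | ∀ j, 0 ≤ P.ineq j x} := by
    ext y
    simp [hzero y]
  have h1 := P.finrank_facet i
  rw [hset, ← direction_affineSpan, (affineSpan_eq_top_of_nonempty_interior
    (P.interior_nonempty.mono (interior_mono (subset_convexHull ℝ _)))), AffineSubspace.direction_top,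
    finrank_top, finrank_euclideanSpace_fin] at h1
  omega

theorem inner_convex : Convex ℝ P.inner := by
  intro x hx y hy a b ha hb hab i
  obtain rfl : a = 1 - b := by linarith
  rw [← AffineMap.lineMap_apply_module, ineq_lineMap]
  rcases hb.eq_or_lt with rfl | hb
  · simpa using hx i
  · have := mul_pos hb (hy i)
    have := mul_nonneg ha (hx i).le
    linarith

theorem carrier_subset_closure_inner : P.carrier ⊆ closure P.inner := by
  intro p hp
  obtain ⟨x, hx⟩ := P.inner_nonempty
  have hc : Continuous fun t : ℝ => (AffineMap.lineMap p x t : EuclideanSpace ℝ (Fin n)) :=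
    AffineMap.lineMap_continuous
  have h0 := (hc.tendsto 0).mono_left (nhdsWithin_le_nhds (s := Set.Ioi 0))
  rw [AffineMap.lineMap_apply_zero] at h0
  refine mem_closure_of_tendsto h0 ?_
  filter_upwards [Ioo_mem_nhdsGT (show (0 : ℝ) < 1 by norm_num)] with t ht i
  rw [ineq_lineMap]
  have := mul_pos ht.1 (hx i)
  have := mul_nonneg (sub_nonneg.2 ht.2.le) (hp i)
  linarith

/-- The values at `p` of the affine functions of the facets enumerated by `e`. -/
def facetCoords {s : Set (Fin m)} (e : Fin n ≃ s) (p : EuclideanSpace ℝ (Fin n)) : Fin n → ℝ :=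
  fun k => P.ineq (e k) p

theorem continuous_facetCoords {s : Set (Fin m)} (e : Fin n ≃ s) : Continuous (P.facetCoords e) :=
  continuous_pi fun k => P.continuous_ineq (e k)

theorem exists_enum {v : EuclideanSpace ℝ (Fin n)} (hv : v ∈ P.vertices) :
    Nonempty (Fin n ≃ P.facetsAt v) := by
  have h := P.ncard_facetsAt hv
  rw [← Nat.card_coe_set_eq] at h
  exact ⟨((Finite.equivFin (P.facetsAt v)).trans (finCongr h)).symm⟩

variable {v : EuclideanSpace ℝ (Fin n)}

/-- The linear part of `facetCoords` at a vertex. -/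
def facetCoordsLinear (hv : v ∈ P.vertices) (e : Fin n ≃ P.facetsAt v) :
    EuclideanSpace ℝ (Fin n) ≃ₗ[ℝ] (Fin n → ℝ) :=
  LinearEquiv.ofInjectiveOfFinrankEq (LinearMap.pi fun k => (P.ineq (e k)).linear) (by
    rw [← LinearMap.ker_eq_bot, LinearMap.ker_eq_bot']
    intro d hd
    refine P.eq_zero_of_linear_eq_zero hv fun i hi => ?_
    have := congrFun hd (e.symm ⟨i, hi⟩)
    simpa using this) (by simp)

/-- The inverse of `facetCoords` at a vertex. -/
def vertexParam (hv : v ∈ P.vertices) (e : Fin n ≃ P.facetsAt v) (r : Fin n → ℝ) :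
    EuclideanSpace ℝ (Fin n) :=
  (P.facetCoordsLinear hv e).symm r + v

theorem contDiff_vertexParam (hv : v ∈ P.vertices) (e : Fin n ≃ P.facetsAt v) :
    ContDiff ℝ ∞ (P.vertexParam hv e) := by
  unfold vertexParam
  exact (LinearMap.toContinuousLinearMap
    (P.facetCoordsLinear hv e).symm.toLinearMap).contDiff.add contDiff_const

theorem facetCoords_vertexParam (hv : v ∈ P.vertices) (e : Fin n ≃ P.facetsAt v)
    (r : Fin n → ℝ) : P.facetCoords e (P.vertexParam hv e r) = r := by
  ext k
  rw [facetCoords, vertexParam, ineq_add, (e k).2.2, add_zero]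
  exact congrFun ((P.facetCoordsLinear hv e).apply_symm_apply r) k

theorem vertexParam_facetCoords (hv : v ∈ P.vertices) (e : Fin n ≃ P.facetsAt v)
    (p : EuclideanSpace ℝ (Fin n)) : P.vertexParam hv e (P.facetCoords e p) = p := by
  have h : P.facetCoords e p = P.facetCoordsLinear hv e (p - v) := by
    ext k
    have := P.ineq_add (e k) v (p - v)
    rw [sub_add_cancel, (e k).2.2, add_zero] at this
    exact this
  rw [vertexParam, h, LinearEquiv.symm_apply_apply, sub_add_cancel]

theorem facetCoords_injective (hv : v ∈ P.vertices) (e : Fin n ≃ P.facetsAt v) :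
    Function.Injective (P.facetCoords e) :=
  Function.LeftInverse.injective (P.vertexParam_facetCoords hv e)

end SimplePolytope

/-! ### Calculus in `N_ℝ`. -/

namespace RealExt

variable {N : Type*} [AddCommGroup N]

theorem smul_tmul (r a : ℝ) (x : N) : r • RealExt.tmul a x = RealExt.tmul (r * a) x := rfl

theorem incl_eq (x : N) : RealExt.incl N x = RealExt.tmul 1 x := rfl

theorem tmul_zsmul (a : ℝ) (k : ℤ) (x : N) :
    RealExt.tmul a (k • x) = RealExt.tmul (a * k) x := by
  change a ⊗ₜ[ℤ] (k • x) = (a * k) ⊗ₜ[ℤ] x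
  rw [← TensorProduct.smul_tmul, zsmul_eq_mul, mul_comm]

theorem tmul_eq_smul_incl (a : ℝ) (x : N) : RealExt.tmul a x = a • RealExt.incl N x := by
  rw [incl_eq, smul_tmul, mul_one]

theorem map_tmul {N' : Type*} [AddCommGroup N'] (g : N →ₗ[ℤ] N') (a : ℝ) (x : N) :
    RealExt.map g (RealExt.tmul a x) = RealExt.tmul a (g x) :=
  TensorProduct.map_tmul _ _ _ _

theorem induction {C : RealExt N → Prop} (x : RealExt N) (zero : C 0)
    (tmul : ∀ a y, C (RealExt.tmul a y)) (add : ∀ x y, C x → C y → C (x + y)) : C x :=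
  TensorProduct.induction_on x zero tmul add

theorem continuousAdd : ContinuousAdd (RealExt N) := IsModuleTopology.toContinuousAdd ℝ _

theorem continuousSMul : ContinuousSMul ℝ (RealExt N) := IsModuleTopology.toContinuousSMul ℝ _

end RealExt

/-! ### Frames of `N_ℝ` formed by characteristic vectors. -/

namespace CombinatorialModel

variable {n m : ℕ} {P : SimplePolytope n m} {N : Type*} [AddCommGroup N]
  (M : CombinatorialModel P N)

/-- The real linear combinations of all characteristic vectors. -/
def combo : (Fin m → ℝ) →ₗ[ℝ] RealExt N :=
  Fintype.linearCombination ℝ fun i => RealExt.incl N (M.vec i)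

theorem combo_apply (c : Fin m → ℝ) : M.combo c = ∑ i, RealExt.tmul (c i) (M.vec i) := by
  simp [combo, Fintype.linearCombination_apply, RealExt.tmul_eq_smul_incl]

/-- The real linear combinations of the characteristic vectors enumerated by `e`. -/
def frame {s : Set (Fin m)} (e : Fin n ≃ s) : (Fin n → ℝ) →ₗ[ℝ] RealExt N :=
  Fintype.linearCombination ℝ fun k => RealExt.incl N (M.vec (e k))

theorem frame_apply {s : Set (Fin m)} (e : Fin n ≃ s) (a : Fin n → ℝ) :
    M.frame e a = ∑ k, RealExt.tmul (a k) (M.vec (e k)) := by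
  simp [frame, Fintype.linearCombination_apply, RealExt.tmul_eq_smul_incl]

theorem combo_eq_frame {s : Set (Fin m)} (e : Fin n ≃ s) (c : Fin m → ℝ)
    (hc : ∀ i ∉ s, c i = 0) : M.combo c = M.frame e fun k => c (e k) := by
  classical
  rw [combo_apply, frame_apply,
    Equiv.sum_comp e (fun j : s => RealExt.tmul (c j) (M.vec j)),
    ← Finset.sum_subset (Finset.subset_univ s.toFinset)]
  · exact (Finset.sum_subtype s.toFinset (by simp) fun i => RealExt.tmul (c i) (M.vec i))
  · intro i _ hi
    rw [hc i (by simpa using hi), RealExt.tmul_eq_smul_incl, zero_smul]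

variable {v : EuclideanSpace ℝ (Fin n)}

theorem linearIndependent_enum (hv : v ∈ P.vertices) (e : Fin n ≃ P.facetsAt v) :
    LinearIndependent ℤ fun k => M.vec (e k) :=
  (M.linearIndependent (P.facetsAt v) ⟨v, extremePoints_subset hv, fun _ hi => hi⟩).comp e
    e.injective

theorem faceModule_eq_span (e : Fin n ≃ P.facetsAt v) :
    M.faceModule v = Submodule.span ℤ (Set.range fun k => M.vec (e k)) := by
  have hs : M.vec '' P.facetsAt v = Set.range fun k => M.vec (e k) := ?_
  · rw [faceModule, hs]
  ext x
  constructor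
  · rintro ⟨i, hi, rfl⟩
    exact ⟨e.symm ⟨i, hi⟩, by simp⟩
  · rintro ⟨k, rfl⟩
    exact ⟨e k, (e k).2, rfl⟩

theorem exists_frame_eq_incl (e : Fin n ≃ P.facetsAt v) {x : N} (hx : x ∈ M.faceModule v) :
    ∃ k : Fin n → ℤ, RealExt.incl N x = M.frame e fun i => (k i : ℝ) := by
  rw [M.faceModule_eq_span e] at hx
  obtain ⟨k, rfl⟩ := (Submodule.mem_span_range_iff_exists_fun ℤ).1 hx
  refine ⟨k, ?_⟩
  rw [frame_apply, map_sum]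
  refine Finset.sum_congr rfl fun i _ => ?_
  rw [map_zsmul, RealExt.tmul_eq_smul_incl, Int.cast_smul_eq_zsmul]

/-- `N(v)` is spanned by `n` independent vectors, so it has the full rank `n` of `N`. -/
theorem finite_quotient_faceModule (hv : v ∈ P.vertices) : Finite (N ⧸ M.faceModule v) := by
  have := M.free
  have := M.finite
  obtain ⟨e⟩ := P.exists_enum hv
  refine Submodule.finiteQuotientOfFreeOfRankEq _ ?_
  have h := finrank_span_eq_card (M.linearIndependent_enum hv e)
  rw [Fintype.card_fin] at h
  rw [M.faceModule_eq_span e]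
  exact h.trans M.finrank_eq.symm

/-- The index of `N(v)` multiplies every lattice vector into `N(v)`, and over `ℝ` one can divide by
it. -/
theorem frame_surjective (hv : v ∈ P.vertices) (e : Fin n ≃ P.facetsAt v) :
    Function.Surjective (M.frame e) := by
  rw [← LinearMap.range_eq_top, eq_top_iff]
  have hface : ∀ x ∈ M.faceModule v, RealExt.incl N x ∈ LinearMap.range (M.frame e) := by
    intro x hx
    induction hx using Submodule.span_induction with
    | mem x hx =>
      classical
      obtain ⟨i, hi, rfl⟩ := hx
      refine ⟨Pi.single (e.symm ⟨i, hi⟩) 1, ?_⟩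
      simp [frame, Fintype.linearCombination_apply_single]
    | zero => rw [map_zero]; exact zero_mem _
    | add x y _ _ hx hy => rw [map_add]; exact add_mem hx hy
    | smul k x _ hx =>
      rw [map_zsmul]
      exact zsmul_mem hx k
  intro τ _
  induction τ using RealExt.induction with
  | zero => exact zero_mem _
  | add x y hx hy => exact add_mem (hx trivial) (hy trivial)
  | tmul a x =>
    have := M.finite_quotient_faceModule hv
    obtain ⟨k, hk, hx⟩ : ∃ k : ℕ, 0 < k ∧ k • x ∈ M.faceModule v := by
      refine ⟨Nat.card (N ⧸ M.faceModule v), Nat.card_pos, ?_⟩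
      rw [← Submodule.Quotient.mk_eq_zero, Submodule.Quotient.mk_smul]
      exact card_nsmul_eq_zero'
    have h := hface _ hx
    rw [map_nsmul, ← Nat.cast_smul_eq_nsmul ℝ] at h
    have h2 := Submodule.smul_mem _ (a * (k : ℝ)⁻¹) h
    have hk' : (k : ℝ) ≠ 0 := by positivity
    rwa [smul_smul, mul_assoc, inv_mul_cancel₀ hk', mul_one, ← RealExt.tmul_eq_smul_incl] at h2

theorem finite_realExt (M : CombinatorialModel P N) : Module.Finite ℝ (RealExt N) := by
  obtain ⟨v, hv⟩ := P.vertices_nonempty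
  obtain ⟨e⟩ := P.exists_enum hv
  exact Module.Finite.of_surjective _ (M.frame_surjective hv e)

theorem finrank_realExt (M : CombinatorialModel P N) : Module.finrank ℝ (RealExt N) = n := by
  have := M.free
  have := M.finite
  exact (Module.finrank_baseChange (R := ℝ) (S := ℤ) (M' := N)).trans M.finrank_eq

theorem frame_bijective (hv : v ∈ P.vertices) (e : Fin n ≃ P.facetsAt v) :
    Function.Bijective (M.frame e) := by
  have := M.finite_realExt
  refine ⟨?_, M.frame_surjective hv e⟩
  rw [LinearMap.injective_iff_surjective_of_finrank_eq_finrank]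
  · exact M.frame_surjective hv e
  · rw [M.finrank_realExt, Module.finrank_fin_fun]

/-- `N_ℝ` in the basis given by the characteristic vectors at a vertex. -/
def frameEquiv (hv : v ∈ P.vertices) (e : Fin n ≃ P.facetsAt v) :
    (Fin n → ℝ) ≃ₗ[ℝ] RealExt N :=
  LinearEquiv.ofBijective (M.frame e) (M.frame_bijective hv e)

theorem frameEquiv_apply (hv : v ∈ P.vertices) (e : Fin n ≃ P.facetsAt v) (a : Fin n → ℝ) :
    M.frameEquiv hv e a = M.frame e a := rfl

theorem frame_frameEquiv_symm (hv : v ∈ P.vertices) (e : Fin n ≃ P.facetsAt v) (τ : RealExt N) :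
    M.frame e ((M.frameEquiv hv e).symm τ) = τ :=
  (M.frameEquiv hv e).apply_symm_apply τ

theorem continuous_frame {s : Set (Fin m)} (e : Fin n ≃ s) : Continuous (M.frame e) := by
  have : ContinuousAdd (RealExt N) := RealExt.continuousAdd
  have : ContinuousSMul ℝ (RealExt N) := RealExt.continuousSMul
  exact LinearMap.continuous_on_pi _

theorem continuous_frameEquiv_symm (hv : v ∈ P.vertices) (e : Fin n ≃ P.facetsAt v) :
    Continuous (M.frameEquiv hv e).symm :=
  IsModuleTopology.continuous_of_linearMap (M.frameEquiv hv e).symm.toLinearMap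

/-! ### Points of the space of a model -/

theorem mk_incl (x : N) : Torus.mk N (RealExt.incl N x) = 0 :=
  (QuotientAddGroup.eq_zero_iff _).2 ⟨x, rfl⟩

theorem mk_eq_zero_iff {τ : RealExt N} : Torus.mk N τ = 0 ↔ ∃ x, RealExt.incl N x = τ :=
  QuotientAddGroup.eq_zero_iff _

theorem mk_frame_intCast {s : Set (Fin m)} (e : Fin n ≃ s) (k : Fin n → ℤ) :
    Torus.mk N (M.frame e fun i => (k i : ℝ)) = 0 := by
  rw [frame_apply, map_sum]
  refine Finset.sum_eq_zero fun i _ => ?_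
  rw [← one_mul (k i : ℝ), ← RealExt.tmul_zsmul, ← RealExt.incl_eq, mk_incl]

/-- Coefficients are indexed by all facets, with support at `p`, so that the same `c` can later be
read in the frame of any vertex whose facets include those through `p`. -/
theorem exists_combo_of_mem_faceModule {p : EuclideanSpace ℝ (Fin n)}
    (w : RealExt (M.faceModule p)) : ∃ c : Fin m → ℝ, (∀ i ∉ P.facetsAt p, c i = 0) ∧
      RealExt.map (M.faceModule p).subtype w = M.combo c := by
  induction w using RealExt.induction with
  | zero => exact ⟨0, fun _ _ => rfl, by simp⟩
  | add x y hx hy =>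
    obtain ⟨c, hc, hx⟩ := hx
    obtain ⟨d, hd, hy⟩ := hy
    exact ⟨c + d, fun i hi => by simp [hc i hi, hd i hi], by rw [map_add, map_add, hx, hy]⟩
  | tmul a y =>
    obtain ⟨y, hy⟩ := y
    rw [RealExt.map_tmul, Submodule.subtype_apply]
    simp only
    induction hy using Submodule.span_induction with
    | mem y hy =>
      classical
      obtain ⟨i, hi, rfl⟩ := hy
      refine ⟨Pi.single i a, fun j hj => ?_, ?_⟩
      · exact Pi.single_eq_of_ne (fun h : j = i => hj (h ▸ hi)) _
      · simp [combo, Fintype.linearCombination_apply_single, RealExt.tmul_eq_smul_incl]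
    | zero => exact ⟨0, fun _ _ => rfl, by simp [RealExt.tmul_eq_smul_incl]⟩
    | add x y _ _ hx hy =>
      obtain ⟨c, hc, hx⟩ := hx
      obtain ⟨d, hd, hy⟩ := hy
      refine ⟨c + d, fun i hi => by simp [hc i hi, hd i hi], ?_⟩
      rw [map_add, ← hx, ← hy]
      simp [RealExt.tmul_eq_smul_incl]
    | smul k x _ hx =>
      obtain ⟨c, hc, hx⟩ := hx
      refine ⟨k • c, fun i hi => by simp [hc i hi], ?_⟩
      rw [map_zsmul, ← hx]
      simp only [RealExt.tmul_eq_smul_incl, map_zsmul]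
      exact smul_comm _ _ _

/-- This lifts `∼` from the torus to `N_ℝ`: `x` is the ambiguity of a representative modulo `N`, and
`M.combo c` comes from the collapsed subtorus. -/
theorem point_eq_point_iff {p q : P.carrier} {τ σ : RealExt N} :
    M.point p (Torus.mk N τ) = M.point q (Torus.mk N σ) ↔
      p = q ∧ ∃ (x : N) (c : Fin m → ℝ), (∀ i ∉ P.facetsAt p, c i = 0) ∧
        τ = RealExt.incl N x + M.combo c + σ := by
  refine Quotient.eq.trans (and_congr_right fun _ => ?_)
  constructor
  · rintro ⟨w, hw⟩
    obtain ⟨w, rfl⟩ := QuotientAddGroup.mk_surjective w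
    change Torus.mk N (RealExt.map (M.faceModule p).subtype w) = Torus.mk N τ - Torus.mk N σ at hw
    obtain ⟨c, hc, h⟩ := M.exists_combo_of_mem_faceModule w
    rw [h, ← map_sub, eq_comm, ← sub_eq_zero, ← map_sub, mk_eq_zero_iff] at hw
    obtain ⟨x, hx⟩ := hw
    exact ⟨x, c, hc, by rw [hx]; abel⟩
  · rintro ⟨x, c, hc, h⟩
    classical
    have hmem : ∀ i : P.facetsAt (p : EuclideanSpace ℝ (Fin n)), M.vec i ∈ M.faceModule p :=
      fun i => Submodule.subset_span ⟨i, i.2, rfl⟩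
    refine ⟨Torus.mk _ (∑ i : P.facetsAt (p : EuclideanSpace ℝ (Fin n)),
      RealExt.tmul (c i) ⟨M.vec i, hmem i⟩), ?_⟩
    change Torus.mk N (RealExt.map (M.faceModule p).subtype _) = Torus.mk N τ - Torus.mk N σ
    rw [← map_sub, h, add_sub_cancel_right, map_add (Torus.mk N) (RealExt.incl N x),
      mk_incl, zero_add, map_sum, combo_apply]
    congr 1
    rw [← Finset.sum_subset (Finset.subset_univ (P.facetsAt (p : EuclideanSpace ℝ (Fin n))).toFinset)]
    · exact (Finset.sum_subtype (P.facetsAt (p : EuclideanSpace ℝ (Fin n))).toFinset (by simp)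
        fun i => RealExt.tmul (c i) (M.vec i)).symm
    · intro i _ hi
      rw [hc i (by simpa using hi), RealExt.tmul_eq_smul_incl, zero_smul]

theorem point_surjective (x : M.Space) : ∃ (p : P.carrier) (τ : RealExt N),
    x = M.point p (Torus.mk N τ) := by
  obtain ⟨⟨p, t⟩, rfl⟩ := Quotient.exists_rep x
  obtain ⟨τ, rfl⟩ := QuotientAddGroup.mk_surjective t
  exact ⟨p, τ, rfl⟩

/-- The projection of `P × N_ℝ` to the space of the model. -/
def proj (x : P.carrier × RealExt N) : M.Space := M.point x.1 (Torus.mk N x.2)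

/-- A product of quotient maps need not be one; here both factors are also open. -/
theorem isQuotientMap_proj : Topology.IsQuotientMap M.proj := by
  have : ContinuousAdd (RealExt N) := RealExt.continuousAdd
  have h1 : IsOpenQuotientMap (Prod.map id (Torus.mk N) : P.carrier × RealExt N → _) :=
    IsOpenQuotientMap.id.prodMap QuotientAddGroup.isOpenQuotientMap_mk
  have h2 : Topology.IsQuotientMap (Quotient.mk M.setoid) := isQuotientMap_quotient_mk'
  exact h2.comp h1.isQuotientMap

/-- The projection of the space of the model to the polytope. -/
def base : M.Space → P.carrier :=
  Quotient.lift (fun x => x.1) fun _ _ h => h.1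

theorem continuous_base : Continuous M.base :=
  M.isQuotientMap_proj.continuous_iff.2 continuous_fst

theorem vadd_point (s : Torus N) (p : P.carrier) (t : Torus N) :
    s +ᵥ M.point p t = M.point p (s + t) := rfl

theorem continuous_vadd (s : Torus N) : Continuous fun x : M.Space => s +ᵥ x := by
  have : ContinuousAdd (RealExt N) := RealExt.continuousAdd
  obtain ⟨σ, rfl⟩ := QuotientAddGroup.mk_surjective s
  refine M.isQuotientMap_proj.continuous_iff.2 ?_
  exact M.isQuotientMap_proj.continuous.comp
    (g := M.proj) (f := fun x : P.carrier × RealExt N => (x.1, σ + x.2)) (by fun_prop)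

end CombinatorialModel

/-! ### Polar coordinates on `ℂⁿ`. -/

/-- The vector of complex numbers with squared absolute values `r` and arguments `2π a`. -/
def polar {n : ℕ} (r a : Fin n → ℝ) : Fin n → ℂ :=
  fun k => (Real.sqrt (r k) : ℂ) * Complex.exp (2 * Real.pi * Complex.I * a k)

/-- The rotation of the coordinates by the angles `2π b`. -/
def torusRotation {n : ℕ} (b : Fin n → ℝ) (z : Fin n → ℂ) : Fin n → ℂ :=
  fun k => Complex.exp (2 * Real.pi * Complex.I * b k) * z k

theorem norm_exp_two_pi (a : ℝ) : ‖Complex.exp (2 * Real.pi * Complex.I * a)‖ = 1 := by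
  rw [show (2 * Real.pi * Complex.I * a : ℂ) = ((2 * Real.pi * a : ℝ) : ℂ) * Complex.I by
    push_cast; ring]
  exact Complex.norm_exp_ofReal_mul_I _

theorem norm_polar_sq {n : ℕ} {r a : Fin n → ℝ} (hr : ∀ k, 0 ≤ r k) (k : Fin n) :
    ‖polar r a k‖ ^ 2 = r k := by
  rw [polar, norm_mul, norm_exp_two_pi, mul_one, Complex.norm_real, Real.norm_eq_abs, sq_abs,
    Real.sq_sqrt (hr k)]

theorem polar_add {n : ℕ} (r a b : Fin n → ℝ) : polar r (a + b) = torusRotation b (polar r a) := by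
  ext k
  simp only [polar, torusRotation, Pi.add_apply]
  push_cast
  rw [mul_add, Complex.exp_add]
  ring

theorem torusRotation_torusRotation {n : ℕ} (a b : Fin n → ℝ) (z : Fin n → ℂ) :
    torusRotation a (torusRotation b z) = torusRotation (a + b) z := by
  ext k
  simp only [torusRotation, Pi.add_apply]
  push_cast
  rw [mul_add, Complex.exp_add]
  ring

theorem torusRotation_zero {n : ℕ} (z : Fin n → ℂ) : torusRotation 0 z = z := by
  ext k
  simp [torusRotation]

theorem norm_torusRotation {n : ℕ} (b : Fin n → ℝ) (z : Fin n → ℂ) (k : Fin n) :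
    ‖torusRotation b z k‖ = ‖z k‖ := by
  rw [torusRotation, norm_mul, norm_exp_two_pi, one_mul]

theorem contDiff_torusRotation {n : ℕ} (b : Fin n → ℝ) : ContDiff ℝ ∞ (torusRotation b) :=
  contDiff_pi.2 fun k => contDiff_const.mul (contDiff_apply ℝ ℂ k)

theorem exp_two_pi_eq_iff (a b : ℝ) : Complex.exp (2 * Real.pi * Complex.I * a) =
    Complex.exp (2 * Real.pi * Complex.I * b) ↔ ∃ k : ℤ, a = b + k := by
  rw [Complex.exp_eq_exp_iff_exists_int]
  refine exists_congr fun k => ?_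
  have h : (2 * Real.pi * Complex.I : ℂ) ≠ 0 := Complex.two_pi_I_ne_zero
  rw [show (2 * Real.pi * Complex.I * b + k * (2 * Real.pi * Complex.I) : ℂ) =
    2 * Real.pi * Complex.I * (b + k) by ring, mul_right_inj' h]
  norm_cast

theorem polar_eq_polar_iff {n : ℕ} {r a b : Fin n → ℝ} (hr : ∀ k, 0 ≤ r k) :
    polar r a = polar r b ↔ ∀ k, r k ≠ 0 → ∃ j : ℤ, a k = b k + j := by
  rw [funext_iff]
  refine forall_congr' fun k => ?_
  rw [← exp_two_pi_eq_iff, polar, polar, mul_eq_mul_left_iff, Complex.ofReal_eq_zero,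
    Real.sqrt_eq_zero (hr k)]
  tauto

theorem eq_polar {n : ℕ} (z : Fin n → ℂ) :
    z = polar (fun k => ‖z k‖ ^ 2) fun k => Complex.arg (z k) / (2 * Real.pi) := by
  ext k
  rw [polar, Real.sqrt_sq (norm_nonneg _)]
  conv_lhs => rw [← Complex.norm_mul_exp_arg_mul_I (z k)]
  congr 2
  push_cast
  field_simp

theorem continuous_polar {n : ℕ} : Continuous fun x : (Fin n → ℝ) × (Fin n → ℝ) =>
    polar x.1 x.2 := by
  unfold polar
  fun_prop

/-! ### The moment map and the chart domains. -/

namespace SimplePolytope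

variable {n m : ℕ} (P : SimplePolytope n m)

theorem facetCoords_nonneg {s : Set (Fin m)} (e : Fin n ≃ s) {p : EuclideanSpace ℝ (Fin n)}
    (hp : p ∈ P.carrier) (k : Fin n) : 0 ≤ P.facetCoords e p k := hp _

/-- The squared absolute values of the coordinates of `z`, as a point of the affine space of the
polytope. -/
def moment {v : EuclideanSpace ℝ (Fin n)} (hv : v ∈ P.vertices) (e : Fin n ≃ P.facetsAt v)
    (z : Fin n → ℂ) : EuclideanSpace ℝ (Fin n) :=
  P.vertexParam hv e fun k => ‖z k‖ ^ 2

variable {P} {v : EuclideanSpace ℝ (Fin n)} (hv : v ∈ P.vertices) (e : Fin n ≃ P.facetsAt v)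

theorem contDiff_moment : ContDiff ℝ ∞ (P.moment hv e) :=
  (P.contDiff_vertexParam hv e).comp
    (contDiff_pi.2 fun k => (contDiff_apply ℝ ℂ k).norm_sq ℝ)

theorem facetCoords_moment (z : Fin n → ℂ) :
    P.facetCoords e (P.moment hv e z) = fun k => ‖z k‖ ^ 2 :=
  P.facetCoords_vertexParam hv e _

theorem moment_eq_iff (z : Fin n → ℂ) (p : EuclideanSpace ℝ (Fin n)) :
    P.moment hv e z = p ↔ ∀ k, ‖z k‖ ^ 2 = P.ineq (e k) p := by
  rw [← (P.facetCoords_injective hv e).eq_iff, facetCoords_moment, funext_iff]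
  rfl

theorem moment_polar {p : EuclideanSpace ℝ (Fin n)} (hp : p ∈ P.carrier) (a : Fin n → ℝ) :
    P.moment hv e (polar (P.facetCoords e p) a) = p :=
  (moment_eq_iff hv e _ _).2 fun k => norm_polar_sq (P.facetCoords_nonneg e hp) k

theorem eq_polar_moment (z : Fin n → ℂ) :
    z = polar (P.facetCoords e (P.moment hv e z)) fun k => Complex.arg (z k) / (2 * Real.pi) := by
  rw [facetCoords_moment]
  exact eq_polar z

/-- For a facet through `v` the value at the moment point is a squared absolute value, so its
inequality is automatic. The finitely many strict ones that remain show that the domain is open. -/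
theorem mem_chartDomain_iff {z : Fin n → ℂ} :
    z ∈ CombinatorialModel.chartDomain P v e ↔
      ∀ i ∉ P.facetsAt v, 0 < P.ineq i (P.moment hv e z) := by
  constructor
  · rintro ⟨p, hp, hz⟩ i hi
    rw [(moment_eq_iff hv e z p).2 hz]
    refine lt_of_le_of_ne (hp.1 i) fun h => ?_
    exact hp.2 i hi ⟨hp.1, h.symm⟩
  · intro h
    refine ⟨P.moment hv e z, ⟨fun i => ?_, fun i hi hi' => (h i hi).ne' hi'.2⟩,
      (moment_eq_iff hv e z _).1 rfl⟩
    by_cases hi : i ∈ P.facetsAt v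
    · have := (moment_eq_iff hv e z _).1 rfl (e.symm ⟨i, hi⟩)
      rw [e.apply_symm_apply] at this
      rw [← this]
      positivity
    · exact (h i hi).le

theorem moment_mem_vertexNhd {z : Fin n → ℂ} (hz : z ∈ CombinatorialModel.chartDomain P v e) :
    P.moment hv e z ∈ P.vertexNhd v := by
  obtain ⟨p, hp, h⟩ := hz
  rwa [(moment_eq_iff hv e z p).2 h]

theorem polar_mem_chartDomain {p : EuclideanSpace ℝ (Fin n)} (hp : p ∈ P.vertexNhd v)
    (a : Fin n → ℝ) : polar (P.facetCoords e p) a ∈ CombinatorialModel.chartDomain P v e :=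
  ⟨p, hp, fun k => norm_polar_sq (P.facetCoords_nonneg e hp.1) k⟩

theorem rotation_mem_chartDomain {z : Fin n → ℂ} (hz : z ∈ CombinatorialModel.chartDomain P v e)
    (a : Fin n → ℝ) : torusRotation a z ∈ CombinatorialModel.chartDomain P v e := by
  obtain ⟨p, hp, h⟩ := hz
  exact ⟨p, hp, fun k => by rw [norm_torusRotation, h]⟩

theorem chartBase_eq (z : CombinatorialModel.chartDomain P v e) :
    (CombinatorialModel.chartBase z : EuclideanSpace ℝ (Fin n)) = P.moment hv e z :=
  ((moment_eq_iff hv e z _).2 z.2.choose_spec.2).symm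

/-- The rotation by `2π a` as a transformation of the domain of a chart. -/
def rotationPerm (a : Fin n → ℝ) : Equiv.Perm (CombinatorialModel.chartDomain P v e) where
  toFun z := ⟨torusRotation a z, rotation_mem_chartDomain e z.2 a⟩
  invFun z := ⟨torusRotation (-a) z, rotation_mem_chartDomain e z.2 (-a)⟩
  left_inv z := Subtype.ext (by simp [torusRotation_torusRotation, torusRotation_zero])
  right_inv z := Subtype.ext (by simp [torusRotation_torusRotation, torusRotation_zero])

theorem isSmoothMap_rotationPerm (a : Fin n → ℝ) : IsSmoothMap (rotationPerm (P := P) e a) :=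
  ⟨torusRotation a, (contDiff_torusRotation a).contDiffOn, fun _ => rfl⟩

include hv in
theorem isOpen_chartDomain : IsOpen (CombinatorialModel.chartDomain P v e) := by
  have : CombinatorialModel.chartDomain P v e =
      ⋂ i ∈ (P.facetsAt v)ᶜ, {z | 0 < P.ineq i (P.moment hv e z)} := by
    ext z
    simp [mem_chartDomain_iff hv e]
  rw [this]
  exact (Set.toFinite _).isOpen_biInter fun i _ =>
    isOpen_lt continuous_const ((P.continuous_ineq i).comp (contDiff_moment hv e).continuous)

-- The domain is star-shaped about `0`: scaling `z` by `t` moves its moment point to parameter `t ^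
-- 2` on the segment from `v`, along which the facets away from `v` are avoided.
include hv in
theorem isConnected_chartDomain : IsConnected (CombinatorialModel.chartDomain P v e) := by
  have hvP : v ∈ P.carrier := extremePoints_subset hv
  have h0 : (0 : Fin n → ℂ) ∈ CombinatorialModel.chartDomain P v e :=
    ⟨v, P.mem_vertexNhd_iff.2 ⟨hvP, subset_rfl⟩, fun k => by simp [(e k).2.2]⟩
  have hstar : StarConvex ℝ 0 (CombinatorialModel.chartDomain P v e) := by
    rw [starConvex_zero_iff]
    intro z hz t ht0 ht1
    have hm : P.moment hv e (t • z) = AffineMap.lineMap v (P.moment hv e z) (t ^ 2) := by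
      rw [moment_eq_iff]
      intro k
      rw [ineq_lineMap, (e k).2.2, mul_zero, zero_add, ← (moment_eq_iff hv e z _).1 rfl k,
        Pi.smul_apply, norm_smul, mul_pow, Real.norm_eq_abs, sq_abs]
    rw [mem_chartDomain_iff hv e] at hz ⊢
    intro i hi
    have h1 : 0 < P.ineq i v :=
      lt_of_le_of_ne (hvP i) fun h => hi ((P.mem_facetsAt hvP).2 h.symm)
    rw [hm, ineq_lineMap]
    have h2 := hz i hi
    rcases ht1.eq_or_lt with rfl | ht1
    · simpa using h2
    · have : t ^ 2 < 1 := by nlinarith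
      have := mul_pos (sub_pos.2 this) h1
      have := mul_nonneg (sq_nonneg t) h2.le
      linarith
  exact ⟨⟨0, h0⟩, (hstar.isPathConnected h0).isConnected.isPreconnected⟩

end SimplePolytope

/-! ### The charts at the vertices are orbifold charts. -/

namespace CombinatorialModel

variable {n m : ℕ} {P : SimplePolytope n m} {N : Type*} [AddCommGroup N]
  (M : CombinatorialModel P N) {v : EuclideanSpace ℝ (Fin n)}

open SimplePolytope

/-- The coefficients at facets through `p` are arguments of vanishing coordinates, which `polar`
does not see. What remains of the relation is a lattice vector `b`, that is, an element of `G_v`. -/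
theorem point_frame_eq_iff (hv : v ∈ P.vertices) (e : Fin n ≃ P.facetsAt v) {p q : P.carrier}
    (hp : P.facetsAt p ⊆ P.facetsAt v) {a a' : Fin n → ℝ} :
    M.point p (Torus.mk N (M.frame e a)) = M.point q (Torus.mk N (M.frame e a')) ↔
      p = q ∧ ∃ b, Torus.mk N (M.frame e b) = 0 ∧
        polar (P.facetCoords e p) a = polar (P.facetCoords e p) (a' + b) := by
  rw [point_eq_point_iff]
  refine and_congr_right fun _ => ?_
  simp only [polar_eq_polar_iff (P.facetCoords_nonneg e p.2)]
  have hzero : ∀ k, P.facetCoords e p k ≠ 0 ↔ (e k : Fin m) ∉ P.facetsAt p := fun k =>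
    not_congr (P.mem_facetsAt p.2).symm
  constructor
  · rintro ⟨x, c, hc, h⟩
    refine ⟨(M.frameEquiv hv e).symm (RealExt.incl N x), ?_, fun k hk => ⟨0, ?_⟩⟩
    · rw [frame_frameEquiv_symm, mk_incl]
    · rw [M.combo_eq_frame e c fun i hi => hc i fun hi' => hi (hp hi')] at h
      have h' := congrArg (M.frameEquiv hv e).symm h
      rw [← frameEquiv_apply M hv, ← frameEquiv_apply M hv, ← frameEquiv_apply M hv, map_add,
        map_add, LinearEquiv.symm_apply_apply, LinearEquiv.symm_apply_apply,
        LinearEquiv.symm_apply_apply] at h'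
      have := congrFun h' k
      simp only [Pi.add_apply, hc _ ((hzero k).1 hk)] at this ⊢
      push_cast
      linarith
  · rintro ⟨b, hb, h⟩
    classical
    choose! j hj using h
    -- At a nonzero coordinate an integer accounts for what is left of the difference of arguments;
    -- at a vanishing one the integer is set to `0` and all that is left goes into `c`.
    let j' : Fin n → ℤ := fun k => if P.facetCoords e p k ≠ 0 then j k else 0
    let c : Fin m → ℝ := fun i => if hi : i ∈ P.facetsAt p then
      a (e.symm ⟨i, hp hi⟩) - a' (e.symm ⟨i, hp hi⟩) - b (e.symm ⟨i, hp hi⟩) else 0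
    have hc : ∀ i ∉ P.facetsAt p, c i = 0 := fun i hi => dif_neg hi
    have hsum : a = b + (fun k => (j' k : ℝ)) + (fun k => c (e k)) + a' := by
      ext k
      by_cases hk : P.facetCoords e p k ≠ 0
      · have := hj k hk
        simp only [Pi.add_apply, j', if_pos hk, hc _ ((hzero k).1 hk)] at this ⊢
        linarith
      · have hk' : (e k : Fin m) ∈ P.facetsAt p := by
          have := (hzero k).not.1 hk
          rwa [not_not] at this
        simp only [Pi.add_apply, j', if_neg hk, c, dif_pos hk', Subtype.coe_eta,
          Equiv.symm_apply_apply]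
        push_cast
        ring
    obtain ⟨x, hx⟩ := mk_eq_zero_iff.1 (show Torus.mk N (M.frame e (b + fun k => (j' k : ℝ))) = 0 by
      rw [map_add, map_add (Torus.mk N), hb, mk_frame_intCast, add_zero])
    refine ⟨x, c, hc, ?_⟩
    rw [hx, M.combo_eq_frame e c fun i hi => hc i fun hi' => hi (hp hi'), ← map_add, ← map_add,
      ← hsum]

theorem chart_toFun (e : Fin n ≃ P.facetsAt v) (z : chartDomain P v e) :
    (M.chart v e).toFun z = M.point (chartBase z)
      (Torus.mk N (M.frame e fun k => Complex.arg ((z : Fin n → ℂ) k) / (2 * Real.pi))) := by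
  rw [frame_apply]
  rfl

/-- Any choice of arguments computes the chart, so the jump of `Complex.arg` and its value at `0` do
not matter. -/
theorem chart_polar (hv : v ∈ P.vertices) (e : Fin n ≃ P.facetsAt v) (z : chartDomain P v e)
    {p : P.carrier} {a : Fin n → ℝ}
    (hz : (z : Fin n → ℂ) = polar (P.facetCoords e p) a) :
    (M.chart v e).toFun z = M.point p (Torus.mk N (M.frame e a)) := by
  have hb : (chartBase z : EuclideanSpace ℝ (Fin n)) = p := by
    rw [chartBase_eq hv, hz, moment_polar hv e p.2]
  have hsub : P.facetsAt (chartBase z : EuclideanSpace ℝ (Fin n)) ⊆ P.facetsAt v := by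
    rw [chartBase_eq hv]
    exact (P.mem_vertexNhd_iff.1 (moment_mem_vertexNhd hv e z.2)).2
  rw [chart_toFun, point_frame_eq_iff M hv e hsub]
  refine ⟨Subtype.ext hb, 0, by simp, ?_⟩
  rw [add_zero]
  have h := eq_polar_moment hv e (z : Fin n → ℂ)
  rw [← chartBase_eq hv] at h
  rw [← h, hb, hz]

theorem exists_polar (hv : v ∈ P.vertices) (e : Fin n ≃ P.facetsAt v) (z : chartDomain P v e) :
    ∃ (p : P.carrier) (a : Fin n → ℝ), (p : EuclideanSpace ℝ (Fin n)) ∈ P.vertexNhd v ∧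
      (z : Fin n → ℂ) = polar (P.facetCoords e p) a :=
  ⟨⟨_, (moment_mem_vertexNhd hv e z.2).1⟩, _, moment_mem_vertexNhd hv e z.2,
    eq_polar_moment hv e (z : Fin n → ℂ)⟩

theorem chart_range (hv : v ∈ P.vertices) (e : Fin n ≃ P.facetsAt v) :
    Set.range (M.chart v e).toFun =
      {x | (M.base x : EuclideanSpace ℝ (Fin n)) ∈ P.vertexNhd v} := by
  ext x
  constructor
  · rintro ⟨z, rfl⟩
    obtain ⟨p, a, hp, hz⟩ := exists_polar hv e z
    rw [M.chart_polar hv e z hz]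
    exact hp
  · intro hx
    obtain ⟨p, τ, rfl⟩ := M.point_surjective x
    have hp : (p : EuclideanSpace ℝ (Fin n)) ∈ P.vertexNhd v := hx
    let z : chartDomain P v e :=
      ⟨_, polar_mem_chartDomain e hp ((M.frameEquiv hv e).symm τ)⟩
    refine ⟨z, (M.chart_polar hv e z rfl).trans ?_⟩
    rw [frame_frameEquiv_symm]

/-- `Complex.arg` is not continuous, but its values are bounded. Along an ultrafilter they converge
to some `a₀`, which is again a valid choice of arguments for the limit point, and `chart_polar`
computes the chart there with `a₀`. -/
theorem continuous_chart (hv : v ∈ P.vertices) (e : Fin n ≃ P.facetsAt v) :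
    Continuous (M.chart v e).toFun := by
  refine continuous_iff_ultrafilter.2 fun (z₀ : chartDomain P v e)
    (g : Ultrafilter (chartDomain P v e)) (hg : (g : Filter (chartDomain P v e)) ≤ nhds z₀) => ?_
  let a : chartDomain P v e → Fin n → ℝ :=
    fun z k => Complex.arg ((z : Fin n → ℂ) k) / (2 * Real.pi)
  have hK : IsCompact (Set.univ.pi fun _ : Fin n => Set.Icc (-1 / 2 : ℝ) (1 / 2)) :=
    isCompact_univ_pi fun _ => isCompact_Icc
  obtain ⟨a₀, -, ha₀⟩ := hK.ultrafilter_le_nhds (g.map a) (by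
    rw [Filter.le_principal_iff]
    refine Filter.Eventually.of_forall (f := (g : Filter (chartDomain P v e)))
      (p := fun z => a z ∈ _) fun z k _ => ?_
    have h1 := Complex.neg_pi_lt_arg ((z : Fin n → ℂ) k)
    have h2 := Complex.arg_le_pi ((z : Fin n → ℂ) k)
    have hpi := Real.pi_pos
    constructor
    · rw [le_div_iff₀ (by positivity)]; linarith
    · rw [div_le_iff₀ (by positivity)]; linarith)
  have ha : Filter.Tendsto a g (nhds a₀) := ha₀
  have hval : Filter.Tendsto (fun z : chartDomain P v e => (z : Fin n → ℂ)) g (nhds z₀) :=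
    continuous_subtype_val.continuousAt.tendsto.comp hg
  have hmom : Filter.Tendsto (fun z : chartDomain P v e => P.moment hv e z) g
      (nhds (P.moment hv e z₀)) :=
    ((contDiff_moment hv e).continuous.tendsto _).comp hval
  have hbase : Filter.Tendsto (fun z : chartDomain P v e => chartBase z) g
      (nhds (chartBase z₀)) := by
    rw [tendsto_subtype_rng]
    simpa only [chartBase_eq hv] using hmom
  have hz₀ : (z₀ : Fin n → ℂ) = polar (P.facetCoords e (chartBase z₀)) a₀ := by
    rw [chartBase_eq hv]
    refine tendsto_nhds_unique hval ?_
    have h1 := ((continuous_polar (n := n)).tendsto _).comp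
      ((((P.continuous_facetCoords e).tendsto _).comp hmom).prodMk_nhds ha)
    refine h1.congr fun z => ?_
    exact (eq_polar_moment hv e (z : Fin n → ℂ)).symm
  rw [M.chart_polar hv e z₀ hz₀]
  have h2 := (M.isQuotientMap_proj.continuous.tendsto _).comp
    (hbase.prodMk_nhds (((M.continuous_frame e).tendsto _).comp ha))
  refine h2.congr fun z => ?_
  exact (M.chart_toFun e z).symm

/-- Pulled back to `P × N_ℝ`, the image of `V` is the union over all lattice translations of
preimages of `V` under continuous polar coordinates. -/
theorem isOpenMap_chart (hv : v ∈ P.vertices) (e : Fin n ≃ P.facetsAt v) :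
    IsOpenMap (M.chart v e).toFun := by
  have : ContinuousAdd (RealExt N) := RealExt.continuousAdd
  intro V hV
  rw [← M.isQuotientMap_proj.isOpen_preimage]
  have hV' : IsOpen (Subtype.val '' V : Set (Fin n → ℂ)) :=
    (isOpen_chartDomain hv e).isOpenMap_subtype_val _ hV
  have : M.proj ⁻¹' ((M.chart v e).toFun '' V) = ⋃ y : N, (fun x : P.carrier × RealExt N =>
      polar (P.facetCoords e x.1) ((M.frameEquiv hv e).symm (x.2 + RealExt.incl N y))) ⁻¹'
        (Subtype.val '' V) := by
    ext ⟨p, τ⟩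
    obtain ⟨a, rfl⟩ := M.frame_surjective hv e τ
    simp only [Set.mem_preimage, Set.mem_iUnion]
    constructor
    · rintro ⟨z, hz, h⟩
      obtain ⟨q, a', hq, hz'⟩ := exists_polar hv e z
      rw [M.chart_polar hv e z hz'] at h
      obtain ⟨rfl, b, hb, h'⟩ :=
        (M.point_frame_eq_iff hv e (P.mem_vertexNhd_iff.1 hq).2).1 h
      obtain ⟨y, hy⟩ := mk_eq_zero_iff.1 hb
      refine ⟨y, z, hz, ?_⟩
      rw [hz', h', hy, ← map_add, ← M.frameEquiv_apply hv, LinearEquiv.symm_apply_apply]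
    · rintro ⟨y, z, hz, h⟩
      refine ⟨z, hz, ?_⟩
      rw [M.chart_polar hv e z h, frame_frameEquiv_symm, map_add (Torus.mk N), mk_incl, add_zero]
      rfl
  rw [this]
  refine isOpen_iUnion fun y => hV'.preimage (continuous_polar.comp (Continuous.prodMk ?_ ?_))
  · exact (P.continuous_facetCoords e).comp (continuous_subtype_val.comp continuous_fst)
  · exact (M.continuous_frameEquiv_symm hv e).comp (continuous_snd.add continuous_const)

theorem mem_chartGroup_iff (e : Fin n ≃ P.facetsAt v) {g : Equiv.Perm (chartDomain P v e)} :
    g ∈ M.chartGroup e ↔ ∃ a, Torus.mk N (M.frame e a) = 0 ∧ g = rotationPerm e a := by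
  refine exists_congr fun a => ?_
  rw [frame_apply]
  refine and_congr_right fun _ => ⟨fun h => ?_, fun h z k => by rw [h]; rfl⟩
  exact Equiv.ext fun z => Subtype.ext (funext fun k => h z k)

theorem chart_eq_iff (hv : v ∈ P.vertices) (e : Fin n ≃ P.facetsAt v)
    (x y : chartDomain P v e) : (M.chart v e).toFun x = (M.chart v e).toFun y ↔
      ∃ g ∈ M.chartGroup e, g x = y := by
  obtain ⟨p, a, hp, hx⟩ := exists_polar hv e x
  obtain ⟨q, a', hq, hy⟩ := exists_polar hv e y
  rw [eq_comm, M.chart_polar hv e x hx, M.chart_polar hv e y hy,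
    M.point_frame_eq_iff hv e (P.mem_vertexNhd_iff.1 hq).2]
  constructor
  · rintro ⟨rfl, b, hb, h⟩
    refine ⟨_, (M.mem_chartGroup_iff e).2 ⟨b, hb, rfl⟩, Subtype.ext ?_⟩
    change torusRotation b x = y
    rw [hx, hy, h, polar_add]
  · rintro ⟨g, hg, h⟩
    obtain ⟨b, hb, rfl⟩ := (M.mem_chartGroup_iff e).1 hg
    have h' : torusRotation b x = (y : Fin n → ℂ) := congrArg Subtype.val h
    rw [hx, ← polar_add] at h'
    have hqp : q = p := by
      have := congrArg (P.moment hv e) (h'.trans hy)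
      rw [moment_polar hv e p.2, moment_polar hv e q.2] at this
      exact Subtype.ext this.symm
    subst hqp
    exact ⟨rfl, b, hb, hy.symm.trans h'.symm⟩

/-- Vectors of `N(v)` have integer coordinates in the frame and rotate trivially, so the group is
covered by the finite quotient `N / N(v)`. -/
theorem finite_chartGroup (hv : v ∈ P.vertices) (e : Fin n ≃ P.facetsAt v) :
    Finite (M.chartGroup e) := by
  have := M.finite_quotient_faceModule hv
  let f : N → Equiv.Perm (chartDomain P v e) := fun x =>
    rotationPerm e ((M.frameEquiv hv e).symm (RealExt.incl N x))
  have hf : ∀ x y, x - y ∈ M.faceModule v → f x = f y := by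
    intro x y h
    obtain ⟨k, hk⟩ := M.exists_frame_eq_incl e h
    rw [map_sub, sub_eq_iff_eq_add] at hk
    refine Equiv.ext fun z => Subtype.ext (funext fun i => ?_)
    change Complex.exp _ * _ = Complex.exp _ * _
    congr 1
    rw [exp_two_pi_eq_iff]
    refine ⟨k i, ?_⟩
    rw [hk, map_add, ← M.frameEquiv_apply hv, LinearEquiv.symm_apply_apply, Pi.add_apply, add_comm]
  have hfin : (Set.range fun x : N ⧸ M.faceModule v => f (Quotient.out x)).Finite :=
    Set.finite_range _
  refine (hfin.subset ?_ : ((M.chartGroup e : Set _).Finite))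
  intro g hg
  obtain ⟨a, ha, rfl⟩ := (M.mem_chartGroup_iff e).1 hg
  obtain ⟨x, hx⟩ := mk_eq_zero_iff.1 ha
  refine ⟨Submodule.Quotient.mk x, ?_⟩
  change f _ = _
  rw [hf _ x]
  · simp only [f]
    rw [hx, ← M.frameEquiv_apply hv, LinearEquiv.symm_apply_apply]
  · rw [← Submodule.Quotient.eq]
    exact Quotient.out_eq _

theorem isOrbifoldChart_chart (hv : v ∈ P.vertices) (e : Fin n ≃ P.facetsAt v) :
    (M.chart v e).IsOrbifoldChart where
  isOpen_domain := isOpen_chartDomain hv e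
  isConnected_domain := isConnected_chartDomain hv e
  finite_group := M.finite_chartGroup hv e
  smooth_group g hg := by
    obtain ⟨a, -, rfl⟩ := (M.mem_chartGroup_iff e).1 hg
    exact isSmoothMap_rotationPerm e a
  continuous_toFun := M.continuous_chart hv e
  isOpenMap_toFun := M.isOpenMap_chart hv e
  eq_iff := M.chart_eq_iff hv e

end CombinatorialModel

/-! ### Smooth local branches of the argument. -/

/-- A local branch of `arg (z k) / 2π` near the value `α`. -/
def localArg (α : ℝ) (z : ℂ) : ℝ :=
  α + (Complex.log (z * Complex.exp (2 * Real.pi * Complex.I * (-α : ℝ)))).im / (2 * Real.pi)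

/-- Rotating by `-α` puts the angle in `(-π, π)`, where the principal argument recovers it. -/
theorem localArg_mul_exp {r a α : ℝ} (hr : 0 < r) (h : |a - α| < 1 / 2) :
    localArg α (r * Complex.exp (2 * Real.pi * Complex.I * a)) = a := by
  have hpi := Real.pi_pos
  rw [abs_lt] at h
  have h1 : (r * Complex.exp (2 * Real.pi * Complex.I * a) *
      Complex.exp (2 * Real.pi * Complex.I * (-α : ℝ)) : ℂ) =
      r * (Complex.cos (2 * Real.pi * (a - α) : ℝ) +
        Complex.sin (2 * Real.pi * (a - α) : ℝ) * Complex.I) := by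
    rw [← Complex.exp_mul_I, mul_assoc, ← Complex.exp_add]
    congr 2
    push_cast
    ring
  rw [localArg, Complex.log_im, h1, Complex.arg_mul_cos_add_sin_mul_I hr]
  · field_simp
    ring
  · constructor <;> nlinarith

theorem norm_mul_exp_localArg (α : ℝ) (z : ℂ) :
    (‖z‖ : ℂ) * Complex.exp (2 * Real.pi * Complex.I * localArg α z) = z := by
  set w := z * Complex.exp (2 * Real.pi * Complex.I * (-α : ℝ)) with hw
  have h1 : ‖w‖ = ‖z‖ := by rw [hw, norm_mul, norm_exp_two_pi, mul_one]
  have h2 := Complex.norm_mul_exp_arg_mul_I w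
  have h3 : z = w * Complex.exp (2 * Real.pi * Complex.I * α) := by
    rw [hw, mul_assoc, ← Complex.exp_add]
    simp
  conv_rhs => rw [h3, ← h2, h1, mul_assoc, ← Complex.exp_add]
  rw [localArg, ← hw, Complex.log_im]
  congr 2
  push_cast
  field_simp
  ring

theorem abs_localArg_sub_lt {α : ℝ} {z : ℂ}
    (h : z * Complex.exp (2 * Real.pi * Complex.I * (-α : ℝ)) ∈ Complex.slitPlane) :
    |localArg α z - α| < 1 / 2 := by
  have hpi := Real.pi_pos
  rw [localArg, add_sub_cancel_left, Complex.log_im, abs_div,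
    abs_of_pos (by positivity : 0 < 2 * Real.pi),
    div_lt_iff₀ (by positivity), show 1 / 2 * (2 * Real.pi) = Real.pi by ring, abs_lt]
  exact ⟨Complex.neg_pi_lt_arg _,
    lt_of_le_of_ne (Complex.arg_le_pi _) (Complex.mem_slitPlane_iff_arg.1 h).1⟩

theorem mul_exp_mem_slitPlane {r a α : ℝ} (hr : 0 < r) (h : |a - α| < 1 / 2) :
    (r * Complex.exp (2 * Real.pi * Complex.I * a) : ℂ) *
      Complex.exp (2 * Real.pi * Complex.I * (-α : ℝ)) ∈ Complex.slitPlane := by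
  have hpi := Real.pi_pos
  have h1 := localArg_mul_exp hr h
  rw [localArg, Complex.log_im] at h1
  rw [Complex.mem_slitPlane_iff_arg]
  constructor
  · intro h2
    rw [h2] at h1
    rw [abs_lt] at h
    have : Real.pi / (2 * Real.pi) = 1 / 2 := by field_simp
    linarith
  · exact mul_ne_zero (mul_ne_zero (by exact_mod_cast hr.ne') (Complex.exp_ne_zero _))
      (Complex.exp_ne_zero _)

theorem contDiffAt_localArg {α : ℝ} {z : ℂ}
    (h : z * Complex.exp (2 * Real.pi * Complex.I * (-α : ℝ)) ∈ Complex.slitPlane) :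
    ContDiffAt ℝ ∞ (localArg α) z := by
  have h1 : ContDiffAt ℝ ∞ (fun z : ℂ =>
      Complex.log (z * Complex.exp (2 * Real.pi * Complex.I * (-α : ℝ)))) z :=
    ((Complex.contDiffAt_log h).restrict_scalars ℝ).comp z (contDiffAt_id.mul contDiffAt_const)
  exact contDiffAt_const.add ((Complex.imCLM.contDiff.contDiffAt.comp z h1).div_const _)

/-! ### Compatibility of the charts at two vertices. -/

namespace CombinatorialModel

variable {n m : ℕ} {P : SimplePolytope n m} {N : Type*} [AddCommGroup N]
  (M : CombinatorialModel P N) {v w : EuclideanSpace ℝ (Fin n)}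

open SimplePolytope

/-- The combination supported at facets through `p` is absorbed into the arguments `a`: the
coordinates concerned vanish, so `x` is unchanged and only a lattice vector `s` remains. -/
theorem exists_common_polar (hv : v ∈ P.vertices) (e : Fin n ≃ P.facetsAt v)
    (hw : w ∈ P.vertices) (e' : Fin n ≃ P.facetsAt w) (x : chartDomain P v e)
    (y : chartDomain P w e') (h : (M.chart v e).toFun x = (M.chart w e').toFun y) :
    ∃ (p : P.carrier) (a b : Fin n → ℝ) (s : N),
      (p : EuclideanSpace ℝ (Fin n)) ∈ P.vertexNhd v ∧
      (p : EuclideanSpace ℝ (Fin n)) ∈ P.vertexNhd w ∧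
      (x : Fin n → ℂ) = polar (P.facetCoords e p) a ∧
      (y : Fin n → ℂ) = polar (P.facetCoords e' p) b ∧
      M.frame e a = RealExt.incl N s + M.frame e' b := by
  obtain ⟨p, a, hp, hx⟩ := exists_polar hv e x
  obtain ⟨q, b, hq, hy⟩ := exists_polar hw e' y
  rw [M.chart_polar hv e x hx, M.chart_polar hw e' y hy, point_eq_point_iff] at h
  obtain ⟨rfl, s, c, hc, h⟩ := h
  refine ⟨p, a - fun k => c (e k), b, s, hp, hq, ?_, hy, ?_⟩
  · rw [hx, polar_eq_polar_iff (P.facetCoords_nonneg e p.2)]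
    intro k hk
    refine ⟨0, ?_⟩
    rw [Pi.sub_apply, hc _ fun hk' => hk hk'.2]
    simp
  · rw [map_sub, h, M.combo_eq_frame e c fun i hi => hc i fun hi' =>
      hi ((P.mem_vertexNhd_iff.1 hp).2 hi')]
    abel

/-- The index in the enumeration `e` of the facet with index `l` in the enumeration `e'`. -/
def partner (e : Fin n ≃ P.facetsAt v) (e' : Fin n ≃ P.facetsAt w) (l : Fin n) : Fin n :=
  open Classical in
  -- The default `l` is arbitrary; the index has a meaning only for facets common to both vertices.
  if h : (e' l : Fin m) ∈ P.facetsAt v then e.symm ⟨e' l, h⟩ else l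

theorem enum_partner (e : Fin n ≃ P.facetsAt v) (e' : Fin n ≃ P.facetsAt w) {l : Fin n}
    (h : (e' l : Fin m) ∈ P.facetsAt v) : (e (partner e e' l) : Fin m) = e' l := by
  rw [partner, dif_pos h, Equiv.apply_symm_apply]

-- Facets through `p` contain both vertices, so their vectors belong to both frames and such a
-- combination keeps its coefficients, up to reindexing.
open Classical in
theorem frameEquiv_symm_frame_of_support (e : Fin n ≃ P.facetsAt v)
    (hw : w ∈ P.vertices) (e' : Fin n ≃ P.facetsAt w) {p : EuclideanSpace ℝ (Fin n)}
    (hpv : P.facetsAt p ⊆ P.facetsAt v) (hpw : P.facetsAt p ⊆ P.facetsAt w) {d : Fin n → ℝ}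
    (hd : ∀ k, (e k : Fin m) ∉ P.facetsAt p → d k = 0) (l : Fin n) :
    (M.frameEquiv hw e').symm (M.frame e d) l =
      if (e' l : Fin m) ∈ P.facetsAt p then d (partner e e' l) else 0 := by
  let c : Fin m → ℝ := fun i => if hi : i ∈ P.facetsAt p then d (e.symm ⟨i, hpv hi⟩) else 0
  have hc : ∀ i ∉ P.facetsAt p, c i = 0 := fun i hi => dif_neg hi
  have h1 : (fun k => c (e k)) = d := by
    ext k
    by_cases hk : (e k : Fin m) ∈ P.facetsAt p
    · simp [c, dif_pos hk]
    · rw [hc _ hk, hd k hk]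
  have h2 := M.combo_eq_frame e c fun i hi => hc i fun hi' => hi (hpv hi')
  rw [h1] at h2
  rw [← h2, M.combo_eq_frame e' c fun i hi => hc i fun hi' => hi (hpw hi'),
    ← M.frameEquiv_apply hw, LinearEquiv.symm_apply_apply]
  by_cases hl : (e' l : Fin m) ∈ P.facetsAt p
  · simp only [c, dif_pos hl, if_pos hl, partner, dif_pos (hpv hl)]
  · rw [hc _ hl, if_neg hl]

/-- The transition between the charts at two vertices, near a point over `p`, as a relation. The
arguments of the coordinates that do not vanish at the point are kept close to `α` and `β`. -/
def Transition (e : Fin n ≃ P.facetsAt v) (e' : Fin n ≃ P.facetsAt w)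
    (p : EuclideanSpace ℝ (Fin n)) (α β : Fin n → ℝ) (σ : RealExt N) (z u : Fin n → ℂ) : Prop :=
  ∃ q ∈ P.carrier, P.facetsAt q ⊆ P.facetsAt p ∧ ∃ a b : Fin n → ℝ,
    z = polar (P.facetCoords e q) a ∧ u = polar (P.facetCoords e' q) b ∧
    M.frame e a = σ + M.frame e' b ∧
    (∀ k, (e k : Fin m) ∉ P.facetsAt p → |a k - α k| < 1 / 2) ∧
    ∀ l, (e' l : Fin m) ∉ P.facetsAt p → |b l - β l| < 1 / 2

variable {M} in
theorem Transition.symm {e : Fin n ≃ P.facetsAt v} {e' : Fin n ≃ P.facetsAt w}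
    {p : EuclideanSpace ℝ (Fin n)} {α β : Fin n → ℝ} {σ : RealExt N} {z u : Fin n → ℂ}
    (h : M.Transition e e' p α β σ z u) : M.Transition e' e p β α (-σ) u z := by
  obtain ⟨q, hq, hqp, a, b, hz, hu, hab, ha, hb⟩ := h
  exact ⟨q, hq, hqp, b, a, hu, hz, by rw [hab, neg_add_cancel_left], hb, ha⟩

variable (hv : v ∈ P.vertices) (e : Fin n ≃ P.facetsAt v) (hw : w ∈ P.vertices)
  (e' : Fin n ≃ P.facetsAt w) (p : EuclideanSpace ℝ (Fin n)) (α β : Fin n → ℝ) (σ : RealExt N)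

open Classical in
/-- The arguments of the coordinates that do not vanish over `p`. -/
def transitionArg (z : Fin n → ℂ) : Fin n → ℝ :=
  fun k => if (e k : Fin m) ∈ P.facetsAt p then α k else localArg (α k) (z k)

/-- The arguments of the coordinates after the transition. -/
def transitionArg' (z : Fin n → ℂ) : Fin n → ℝ :=
  (M.frameEquiv hw e').symm (M.frame e (transitionArg e p α z) - σ)

open Classical in
/-- The transition between the charts at two vertices as a function. -/
def transitionFun (z : Fin n → ℂ) : Fin n → ℂ := fun l =>
  -- On a common facet both coordinates have the same absolute value, so the new one is the old one
  -- times a smooth phase. This avoids the argument and the square root at zero; off `p` the root is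
  -- taken of a positive number.
  if (e' l : Fin m) ∈ P.facetsAt p then
    z (partner e e' l) * Complex.exp (2 * Real.pi * Complex.I *
      (M.transitionArg' e hw e' p α σ z l - transitionArg e p α z (partner e e' l) : ℝ))
  else (Real.sqrt (P.ineq (e' l) (P.moment hv e z)) : ℂ) *
    Complex.exp (2 * Real.pi * Complex.I * M.transitionArg' e hw e' p α σ z l)

/-- The set where `transitionFun` is smooth. -/
def transitionDomain : Set (Fin n → ℂ) :=
  {z | (∀ i ∉ P.facetsAt p, 0 < P.ineq i (P.moment hv e z)) ∧
    ∀ k, (e k : Fin m) ∉ P.facetsAt p →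
      z k * Complex.exp (2 * Real.pi * Complex.I * (-α k : ℝ)) ∈ Complex.slitPlane}

theorem isOpen_transitionDomain : IsOpen (transitionDomain hv e p α) := by
  have : transitionDomain hv e p α =
      (⋂ i ∈ (P.facetsAt p)ᶜ, {z | 0 < P.ineq i (P.moment hv e z)}) ∩
      ⋂ k ∈ {k | (e k : Fin m) ∉ P.facetsAt p}, {z | z k *
        Complex.exp (2 * Real.pi * Complex.I * (-α k : ℝ)) ∈ Complex.slitPlane} := by
    ext z
    simp [transitionDomain]
  rw [this]
  refine ((Set.toFinite _).isOpen_biInter fun i _ => isOpen_lt continuous_const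
    ((P.continuous_ineq i).comp (contDiff_moment hv e).continuous)).inter
    ((Set.toFinite _).isOpen_biInter fun k _ => Complex.isOpen_slitPlane.preimage ?_)
  fun_prop

theorem contDiffOn_transitionArg :
    ContDiffOn ℝ ∞ (transitionArg e p α) (transitionDomain hv e p α) := by
  refine contDiffOn_pi.2 fun k => ?_
  by_cases hk : (e k : Fin m) ∈ P.facetsAt p
  · simp only [transitionArg, if_pos hk]
    exact contDiffOn_const
  · simp only [transitionArg, if_neg hk]
    intro z hz
    exact ((contDiffAt_localArg (hz.2 k hk)).comp z
      (contDiff_apply ℝ ℂ k).contDiffAt).contDiffWithinAt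

theorem contDiffOn_transitionArg' :
    ContDiffOn ℝ ∞ (M.transitionArg' e hw e' p α σ) (transitionDomain hv e p α) := by
  have h : M.transitionArg' e hw e' p α σ = fun z =>
      LinearMap.toContinuousLinearMap ((M.frameEquiv hw e').symm.toLinearMap ∘ₗ M.frame e)
        (transitionArg e p α z) - (M.frameEquiv hw e').symm σ := by
    ext1 z
    rw [transitionArg', map_sub]
    rfl
  rw [h]
  exact ((ContinuousLinearMap.contDiff _).comp_contDiffOn
    (contDiffOn_transitionArg hv e p α)).sub contDiffOn_const

theorem contDiff_exp_two_pi :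
    ContDiff ℝ ∞ fun a : ℝ => Complex.exp (2 * Real.pi * Complex.I * a) :=
  (contDiff_const.mul Complex.ofRealCLM.contDiff).cexp

theorem contDiffOn_transitionFun :
    ContDiffOn ℝ ∞ (M.transitionFun hv e hw e' p α σ) (transitionDomain hv e p α) := by
  refine contDiffOn_pi.2 fun l => ?_
  have hB := contDiffOn_pi.1 (M.contDiffOn_transitionArg' hv e hw e' p α σ) l
  by_cases hl : (e' l : Fin m) ∈ P.facetsAt p
  · simp only [transitionFun, if_pos hl]
    have hA := contDiffOn_pi.1 (contDiffOn_transitionArg hv e p α) (partner e e' l)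
    exact (contDiff_apply ℝ ℂ _).contDiffOn.mul (contDiff_exp_two_pi.comp_contDiffOn (hB.sub hA))
  · simp only [transitionFun, if_neg hl]
    refine ContDiffOn.mul ?_ (contDiff_exp_two_pi.comp_contDiffOn hB)
    refine Complex.ofRealCLM.contDiff.comp_contDiffOn (ContDiffOn.sqrt ?_ fun z hz =>
      (hz.1 _ hl).ne')
    have : ContDiff ℝ ∞ (P.ineq (e' l)) :=
      (⟨P.ineq (e' l), P.continuous_ineq _⟩ : EuclideanSpace ℝ (Fin n) →ᴬ[ℝ] ℝ).contDiff
    exact (this.comp (contDiff_moment hv e)).contDiffOn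

variable {e e' p}

theorem sqrt_facetCoords_pos {e : Fin n ≃ P.facetsAt v} {q : EuclideanSpace ℝ (Fin n)}
    (hq : q ∈ P.carrier) (hqp : P.facetsAt q ⊆ P.facetsAt p) {k : Fin n}
    (hk : (e k : Fin m) ∉ P.facetsAt p) : 0 < Real.sqrt (P.facetCoords e q k) :=
  Real.sqrt_pos.2 (lt_of_le_of_ne (hq _) fun h => hk (hqp ((P.mem_facetsAt hq).2 h.symm)))

-- Off `p` the arguments of `z` are determined by the branches. The error made at facets through `p`
-- is carried unchanged to the other frame, so it cancels in the phase and does not affect the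
-- remaining coordinates.
variable {M σ α β} in
include hv in
theorem Transition.eq_transitionFun (hpv : P.facetsAt p ⊆ P.facetsAt v)
    (hpw : P.facetsAt p ⊆ P.facetsAt w) {z u : Fin n → ℂ}
    (h : M.Transition e e' p α β σ z u) : u = M.transitionFun hv e hw e' p α σ z := by
  classical
  obtain ⟨q, hq, hqp, a, b, hz, rfl, hab, ha, hb⟩ := h
  have hA : ∀ k, (e k : Fin m) ∉ P.facetsAt p → transitionArg e p α z k = a k := by
    intro k hk
    rw [transitionArg, if_neg hk, hz]
    exact localArg_mul_exp (sqrt_facetCoords_pos hq hqp hk) (ha k hk)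
  have hd : ∀ k, (e k : Fin m) ∉ P.facetsAt p → (a - transitionArg e p α z) k = 0 := by
    intro k hk
    rw [Pi.sub_apply, hA k hk, sub_self]
  have hB : ∀ l, b l = M.transitionArg' e hw e' p α σ z l +
      if (e' l : Fin m) ∈ P.facetsAt p then (a - transitionArg e p α z) (partner e e' l) else 0 := by
    intro l
    rw [← M.frameEquiv_symm_frame_of_support e hw e' hpv hpw hd, transitionArg', ← Pi.add_apply,
      ← map_add, map_sub (M.frame e), hab]
    rw [show M.frame e (transitionArg e p α z) - σ +
      (σ + M.frame e' b - M.frame e (transitionArg e p α z)) = M.frame e' b by abel,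
      ← M.frameEquiv_apply hw, LinearEquiv.symm_apply_apply]
  ext l
  by_cases hl : (e' l : Fin m) ∈ P.facetsAt p
  · have hBl := hB l
    rw [if_pos hl, Pi.sub_apply] at hBl
    rw [transitionFun, if_pos hl, polar, hz]
    nth_rw 1 [polar]
    rw [mul_assoc (Real.sqrt _ : ℂ) (Complex.exp _) (Complex.exp _), ← Complex.exp_add,
      facetCoords, facetCoords, enum_partner e e' (hpv hl), hBl]
    congr 2
    push_cast
    rw [← hz]
    ring
  · have hBl := hB l
    rw [if_neg hl, add_zero] at hBl
    rw [transitionFun, if_neg hl, polar, hBl, hz, moment_polar hv e hq, ← hz]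
    rfl

-- The source is described by `z` alone, which gives openness. Arguments at facets through `p` can
-- be chosen freely, since they do not influence the components of `b` constrained here.
include hv in
theorem setOf_transition (hpv : P.facetsAt p ⊆ P.facetsAt v) (hpw : P.facetsAt p ⊆ P.facetsAt w) :
    {z | ∃ u, M.Transition e e' p α β σ z u} = transitionDomain hv e p α ∩
      M.transitionArg' e hw e' p α σ ⁻¹'
        {b | ∀ l, (e' l : Fin m) ∉ P.facetsAt p → |b l - β l| < 1 / 2} := by
  classical
  ext z
  constructor
  · rintro ⟨u, q, hq, hqp, a, b, hz, -, hab, ha, hb⟩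
    have hA : ∀ k, (e k : Fin m) ∉ P.facetsAt p → transitionArg e p α z k = a k := by
      intro k hk
      rw [transitionArg, if_neg hk, hz]
      exact localArg_mul_exp (sqrt_facetCoords_pos hq hqp hk) (ha k hk)
    have hd : ∀ k, (e k : Fin m) ∉ P.facetsAt p → (transitionArg e p α z - a) k = 0 := by
      intro k hk
      rw [Pi.sub_apply, hA k hk, sub_self]
    refine ⟨⟨fun i hi => ?_, fun k hk => ?_⟩, fun l hl => ?_⟩
    · rw [hz, moment_polar hv e hq]
      exact lt_of_le_of_ne (hq i) fun h => hi (hqp ((P.mem_facetsAt hq).2 h.symm))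
    · rw [hz]
      exact mul_exp_mem_slitPlane (sqrt_facetCoords_pos hq hqp hk) (ha k hk)
    · have h := M.frameEquiv_symm_frame_of_support e hw e' hpv hpw hd l
      rw [if_neg hl, map_sub, hab] at h
      have hb' : (M.frameEquiv hw e').symm (M.frame e' b) = b :=
        (M.frameEquiv hw e').symm_apply_apply b
      rw [← sub_sub, map_sub (M.frameEquiv hw e').symm (_ - σ), hb'] at h
      have h' : M.transitionArg' e hw e' p α σ z l = b l := sub_eq_zero.1 h
      rw [h']
      exact hb l hl
  · rintro ⟨⟨hz1, hz2⟩, hz3⟩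
    have hzdom : z ∈ chartDomain P v e :=
      (mem_chartDomain_iff hv e).2 fun i hi => hz1 i fun hi' => hi (hpv hi')
    have hqv := P.mem_vertexNhd_iff.1 (moment_mem_vertexNhd hv e hzdom)
    let a : Fin n → ℝ := fun k => if (e k : Fin m) ∈ P.facetsAt p then
      Complex.arg (z k) / (2 * Real.pi) else localArg (α k) (z k)
    have hd : ∀ k, (e k : Fin m) ∉ P.facetsAt p → (a - transitionArg e p α z) k = 0 := by
      intro k hk
      rw [Pi.sub_apply, transitionArg, if_neg hk]
      simp only [a, if_neg hk, sub_self]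
    refine ⟨_, P.moment hv e z, hqv.1, ?_, a, (M.frameEquiv hw e').symm (M.frame e a - σ), ?_, rfl,
      ?_, fun k hk => ?_, fun l hl => ?_⟩
    · intro i hi
      by_contra hi'
      exact (hz1 i hi').ne' hi.2
    · ext k
      by_cases hk : (e k : Fin m) ∈ P.facetsAt p
      · rw [polar]
        simp only [a, if_pos hk]
        exact congrFun (eq_polar_moment hv e z) k
      · rw [polar, facetCoords_moment, Real.sqrt_sq (norm_nonneg _)]
        simp only [a, if_neg hk]
        exact (norm_mul_exp_localArg _ _).symm
    · rw [frame_frameEquiv_symm, add_sub_cancel]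
    · simp only [a, if_neg hk]
      exact abs_localArg_sub_lt (hz2 k hk)
    · have h := M.frameEquiv_symm_frame_of_support e hw e' hpv hpw hd l
      rw [if_neg hl, map_sub (M.frame e)] at h
      have h' : (M.frameEquiv hw e').symm (M.frame e a - σ) l =
          M.transitionArg' e hw e' p α σ z l := by
        rw [transitionArg', ← sub_eq_zero, ← h, ← Pi.sub_apply, ← map_sub, sub_sub_sub_cancel_right]
      rw [h']
      exact hz3 l hl

include hv hw in
theorem isOpen_setOf_transition (hpv : P.facetsAt p ⊆ P.facetsAt v)
    (hpw : P.facetsAt p ⊆ P.facetsAt w) :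
    IsOpen {z | ∃ u, M.Transition e e' p α β σ z u} := by
  rw [M.setOf_transition hv hw α β σ hpv hpw]
  refine (M.contDiffOn_transitionArg' hv e hw e' p α σ).continuousOn.isOpen_inter_preimage
    (isOpen_transitionDomain hv e p α) ?_
  have : {b : Fin n → ℝ | ∀ l, (e' l : Fin m) ∉ P.facetsAt p → |b l - β l| < 1 / 2} =
      ⋂ l ∈ {l | (e' l : Fin m) ∉ P.facetsAt p}, {b | |b l - β l| < 1 / 2} := by
    ext b
    simp
  rw [this]
  exact (Set.toFinite _).isOpen_biInter fun l _ => isOpen_lt (by fun_prop) continuous_const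

include hv in
theorem contDiffOn_transitionFun_setOf (hpv : P.facetsAt p ⊆ P.facetsAt v)
    (hpw : P.facetsAt p ⊆ P.facetsAt w) :
    ContDiffOn ℝ ∞ (M.transitionFun hv e hw e' p α σ)
      {z | ∃ u, M.Transition e e' p α β σ z u} :=
  (M.contDiffOn_transitionFun hv e hw e' p α σ).mono (by
    rw [M.setOf_transition hv hw α β σ hpv hpw]
    exact Set.inter_subset_left)

theorem Transition.mem_chartDomain (hpv : P.facetsAt p ⊆ P.facetsAt v) {z u : Fin n → ℂ}
    {M : CombinatorialModel P N} {σ : RealExt N} {α β : Fin n → ℝ}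
    (h : M.Transition e e' p α β σ z u) : z ∈ chartDomain P v e := by
  obtain ⟨q, hq, hqp, a, b, rfl, -⟩ := h
  exact polar_mem_chartDomain e (P.mem_vertexNhd_iff.2 ⟨hq, hqp.trans hpv⟩) a

/-- `Transition` becomes its own reverse when the vertices are exchanged and `σ` is negated. One
statement about `transitionFun` thus serves for the transition and its inverse. -/
theorem compatible_chart (hv : v ∈ P.vertices) (e : Fin n ≃ P.facetsAt v)
    (hw : w ∈ P.vertices) (e' : Fin n ≃ P.facetsAt w) :
    (M.chart v e).Compatible (M.chart w e') := by
  intro (x : chartDomain P v e) (y : chartDomain P w e') hxy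
  obtain ⟨⟨p, hp⟩, α, β, s, hpv, hpw, hx, hy, hs⟩ := M.exists_common_polar hv e hw e' x y hxy
  have hpv := (P.mem_vertexNhd_iff.1 hpv).2
  have hpw := (P.mem_vertexNhd_iff.1 hpw).2
  set σ := RealExt.incl N s with hσ
  have hR : M.Transition e e' p α β σ x y :=
    ⟨p, hp, subset_rfl, α, β, hx, hy, hs, fun k _ => by simp, fun k _ => by simp⟩
  have hto : ∀ {z u}, M.Transition e e' p α β σ z u → M.transitionFun hv e hw e' p α σ z = u :=
    fun h => (h.eq_transitionFun hv hw hpv hpw).symm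
  have hinv : ∀ {z u}, M.Transition e e' p α β σ z u →
      M.transitionFun hw e' hv e p β (-σ) u = z :=
    fun h => (h.symm.eq_transitionFun hw hv hpw hpv).symm
  have htarget : {u | ∃ z, M.Transition e e' p α β σ z u} =
      {u | ∃ z, M.Transition e' e p β α (-σ) u z} := by
    ext u
    refine exists_congr fun z => ⟨fun h => h.symm, fun h => ?_⟩
    have := h.symm
    rwa [neg_neg] at this
  refine ⟨{
    toFun := M.transitionFun hv e hw e' p α σ
    invFun := M.transitionFun hw e' hv e p β (-σ)
    source := {z | ∃ u, M.Transition e e' p α β σ z u}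
    target := {u | ∃ z, M.Transition e e' p α β σ z u}
    map_source' := by
      rintro z ⟨u, h⟩
      rw [hto h]
      exact ⟨z, h⟩
    map_target' := by
      rintro u ⟨z, h⟩
      rw [hinv h]
      exact ⟨u, h⟩
    left_inv' := by
      rintro z ⟨u, h⟩
      rw [hto h, hinv h]
    right_inv' := by
      rintro u ⟨z, h⟩
      rw [hinv h, hto h]
    open_source := M.isOpen_setOf_transition hv hw α β σ hpv hpw
    open_target := by
      rw [htarget]
      exact M.isOpen_setOf_transition hw hv β α (-σ) hpw hpv
    continuousOn_toFun := (M.contDiffOn_transitionFun_setOf hv hw α β σ hpv hpw).continuousOn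
    continuousOn_invFun := by
      rw [htarget]
      exact (M.contDiffOn_transitionFun_setOf hw hv β α (-σ) hpw hpv).continuousOn }, ⟨y, hR⟩,
    hto hR, ?_, ?_, M.contDiffOn_transitionFun_setOf hv hw α β σ hpv hpw, ?_, ?_⟩
  · rintro z ⟨u, h⟩
    exact h.mem_chartDomain hpv
  · rintro u ⟨z, h⟩
    exact h.symm.mem_chartDomain hpw
  · change ContDiffOn ℝ ∞ (M.transitionFun hw e' hv e p β (-σ))
      {u | ∃ z, M.Transition e e' p α β σ z u}
    rw [htarget]
    exact M.contDiffOn_transitionFun_setOf hw hv β α (-σ) hpw hpv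
  · rintro (z : chartDomain P v e) (u : chartDomain P w e') ⟨u', h⟩ hu
    have hu' : (u : Fin n → ℂ) = u' := hu.trans (hto h)
    obtain ⟨q, hq, hqp, a, b, hz, hu'', hab, -, -⟩ := h
    rw [M.chart_polar hv e z (p := ⟨q, hq⟩) hz,
      M.chart_polar hw e' u (p := ⟨q, hq⟩) (hu'.trans hu''), hab, map_add (Torus.mk N), hσ, mk_incl, zero_add]

end CombinatorialModel

/-! ### General facts on orbifold charts, and the lattice in `N_ℝ`. -/

theorem IsSmoothMap.continuous {E : Type*} [NormedAddCommGroup E] [NormedSpace ℝ E] {D D' : Set E}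
    {g : D → D'} (hg : IsSmoothMap g) : Continuous g := by
  obtain ⟨G, hG, h⟩ := hg
  refine continuous_induced_rng.2 ?_
  rw [show Subtype.val ∘ g = D.domRestrict G from funext h]
  exact hG.continuousOn.domRestrict

theorem IsSmoothMap.id {E : Type*} [NormedAddCommGroup E] [NormedSpace ℝ E] {D : Set E} :
    IsSmoothMap (id : D → D) :=
  ⟨_root_.id, contDiffOn_id, fun _ => rfl⟩

namespace OrbifoldChartData

variable {E : Type*} [NormedAddCommGroup E] [NormedSpace ℝ E] {X : Type*} [TopologicalSpace X]

/-- Lying over the same point is a finite union of graphs of continuous maps, hence a closed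
relation. A product neighbourhood avoiding it has disjoint images, open because the chart map is
open. -/
theorem IsOrbifoldChart.separated {c : OrbifoldChartData E X} (hc : c.IsOrbifoldChart)
    {a b : c.domain} (hab : c.toFun a ≠ c.toFun b) :
    ∃ U V : Set X, IsOpen U ∧ IsOpen V ∧ c.toFun a ∈ U ∧ c.toFun b ∈ V ∧ Disjoint U V := by
  have hclosed : IsClosed {x : c.domain × c.domain | c.toFun x.1 = c.toFun x.2} := by
    have : {x : c.domain × c.domain | c.toFun x.1 = c.toFun x.2} =
        ⋃ g ∈ (c.group : Set (Equiv.Perm c.domain)), {x | g x.1 = x.2} := by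
      ext x
      simp [hc.eq_iff]
    rw [this]
    refine Set.Finite.isClosed_biUnion hc.finite_group fun g hg => ?_
    exact isClosed_eq ((hc.smooth_group g hg).continuous.comp continuous_fst) continuous_snd
  obtain ⟨U, V, hU, hV, ha, hb, hUV⟩ := isOpen_prod_iff.1 hclosed.isOpen_compl a b hab
  refine ⟨_, _, hc.isOpenMap_toFun U hU, hc.isOpenMap_toFun V hV, ⟨a, ha, rfl⟩, ⟨b, hb, rfl⟩, ?_⟩
  rw [Set.disjoint_left]
  rintro _ ⟨x, hx, rfl⟩ ⟨y, hy, hxy⟩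
  exact hUV (Set.mk_mem_prod hx hy) hxy.symm

end OrbifoldChartData

theorem IsOrbifoldAtlas.mem_maximal {E : Type*} [NormedAddCommGroup E] [NormedSpace ℝ E]
    {X : Type*} [TopologicalSpace X] {A : Set (OrbifoldChartData E X)} (hA : IsOrbifoldAtlas A)
    {c : OrbifoldChartData E X} (hc : c ∈ A) : c ∈ maximalOrbifoldAtlas A :=
  ⟨hA.isOrbifoldChart c hc, fun d hd => ⟨hA.compatible c hc d hd, hA.compatible d hd c hc⟩⟩

namespace RealExt

/-- A free module is flat, so injectivity of `ℤ → ℝ` is preserved. -/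
theorem incl_injective {N : Type*} [AddCommGroup N] [Module.Free ℤ N] :
    Function.Injective (RealExt.incl N) :=
  Module.Flat.tensorProduct_mk_injective (R := ℤ) (S := ℝ) (M := N)

end RealExt

namespace CombinatorialModel

variable {n m : ℕ} {P : SimplePolytope n m} {N : Type*} [AddCommGroup N]
  (M : CombinatorialModel P N) {v : EuclideanSpace ℝ (Fin n)}

open SimplePolytope

/-! ### The orbifold structure -/

theorem exists_mem_chart_range (x : M.Space) : ∃ (v : _) (_ : v ∈ P.vertices)
    (e : Fin n ≃ P.facetsAt v), (M.base x : EuclideanSpace ℝ (Fin n)) ∈ P.vertexNhd v ∧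
      x ∈ Set.range (M.chart v e).toFun := by
  obtain ⟨v, hv, hx⟩ := P.exists_mem_vertexNhd (M.base x).2
  obtain ⟨e⟩ := P.exists_enum hv
  refine ⟨v, hv, e, hx, ?_⟩
  rw [M.chart_range hv e]
  exact hx

/-- Points over different points of `P` are separated by `base`; points over the same one lie in a
common chart. -/
theorem t2Space : T2Space M.Space := by
  refine ⟨fun x y hxy => ?_⟩
  by_cases hb : M.base x = M.base y
  · obtain ⟨v, hv, e, hx, a, rfl⟩ := M.exists_mem_chart_range x
    rw [hb] at hx
    have hy : y ∈ Set.range (M.chart v e).toFun := by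
      rw [M.chart_range hv e]
      exact hx
    obtain ⟨b, rfl⟩ := hy
    exact (M.isOrbifoldChart_chart hv e).separated hxy
  · exact separated_by_continuous M.continuous_base hb

/-- Integer vectors in a frame vanish in the torus, so `P × [0,1]ⁿ` already covers the space.
Paracompactness follows from this. -/
theorem compactSpace : CompactSpace M.Space := by
  obtain ⟨v, hv⟩ := P.vertices_nonempty
  obtain ⟨e⟩ := P.exists_enum hv
  have : CompactSpace P.carrier := isCompact_iff_compactSpace.1 P.isCompact_carrier
  have hK : IsCompact ((Set.univ : Set P.carrier) ×ˢ
      Set.univ.pi fun _ : Fin n => Set.Icc (0 : ℝ) 1) :=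
    isCompact_univ.prod (isCompact_univ_pi fun _ => isCompact_Icc)
  have hc : Continuous fun x : P.carrier × (Fin n → ℝ) => M.proj (x.1, M.frame e x.2) :=
    M.isQuotientMap_proj.continuous.comp
      (continuous_fst.prodMk ((M.continuous_frame e).comp continuous_snd))
  refine ⟨?_⟩
  convert hK.image hc
  refine (Set.eq_univ_of_forall fun x => ?_).symm
  obtain ⟨p, τ, rfl⟩ := M.point_surjective x
  obtain ⟨a, rfl⟩ := M.frame_surjective hv e τ
  refine ⟨(p, fun k => Int.fract (a k)), ⟨Set.mem_univ _, fun k _ =>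
    ⟨Int.fract_nonneg _, (Int.fract_lt_one _).le⟩⟩, ?_⟩
  have h : a = (fun k => Int.fract (a k)) + fun k => (⌊a k⌋ : ℝ) :=
    funext fun k => (Int.fract_add_floor (a k)).symm
  conv_rhs => rw [h, map_add, map_add (Torus.mk N), mk_frame_intCast, add_zero]
  rfl

theorem isOrbifoldAtlas_atlas : IsOrbifoldAtlas M.atlas where
  t2Space := M.t2Space
  paracompactSpace := by
    have := M.compactSpace
    infer_instance
  isOrbifoldChart := by
    rintro _ ⟨v, hv, e, rfl⟩
    exact M.isOrbifoldChart_chart hv e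
  compatible := by
    rintro _ ⟨v, hv, e, rfl⟩ _ ⟨w, hw, e', rfl⟩
    exact M.compatible_chart hv e hw e'
  exists_chart x := by
    obtain ⟨v, hv, e, -, hx⟩ := M.exists_mem_chart_range x
    exact ⟨_, ⟨v, hv, e, rfl⟩, hx⟩

theorem chart_mem_maximal (hv : v ∈ P.vertices) (e : Fin n ≃ P.facetsAt v) :
    M.chart v e ∈ maximalOrbifoldAtlas M.atlas :=
  M.isOrbifoldAtlas_atlas.mem_maximal ⟨v, hv, e, rfl⟩

/-! ### Translations -/

/-- The translation by an element of the torus. -/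
def translation (s : Torus N) : M.Space ≃ₜ M.Space where
  toFun x := s +ᵥ x
  invFun x := -s +ᵥ x
  left_inv x := neg_vadd_vadd s x
  right_inv x := vadd_neg_vadd s x
  continuous_toFun := M.continuous_vadd s
  continuous_invFun := M.continuous_vadd (-s)

/-- In the chart at `v` a translation lifts to the rotation by its frame coordinates. -/
theorem isOrbifoldSmooth_vadd (s : Torus N) :
    IsOrbifoldSmooth M.atlas M.atlas fun x => s +ᵥ x := by
  refine ⟨M.continuous_vadd s, fun x => ?_⟩
  obtain ⟨v, hv, e, hx, hx'⟩ := M.exists_mem_chart_range x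
  obtain ⟨σ, rfl⟩ := QuotientAddGroup.mk_surjective s
  obtain ⟨b, rfl⟩ := M.frame_surjective hv e σ
  have key : ∀ z : chartDomain P v e, (M.chart v e).toFun (rotationPerm e b z) =
      Torus.mk N (M.frame e b) +ᵥ (M.chart v e).toFun z := by
    intro z
    obtain ⟨p, a, hp, hz⟩ := exists_polar hv e z
    have hz' : (rotationPerm e b z : Fin n → ℂ) = polar (P.facetCoords e p) (a + b) := by
      rw [polar_add, ← hz]
      rfl
    rw [M.chart_polar hv e _ hz', M.chart_polar hv e z hz, vadd_point, map_add,
      map_add (Torus.mk N), add_comm]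
  refine ⟨_, M.chart_mem_maximal hv e, _, M.chart_mem_maximal hv e, hx', ?_,
    (rotationPerm e b : chartDomain P v e → chartDomain P v e), isSmoothMap_rotationPerm e b, key⟩
  obtain ⟨z, rfl⟩ := hx'
  exact ⟨_, key z⟩

/-- Over the interior no circle is collapsed, so the torus acts freely. -/
theorem vadd_right_cancel_of_inner {p : P.carrier}
    (hp : (p : EuclideanSpace ℝ (Fin n)) ∈ P.inner) {t s s' : Torus N}
    (h : s +ᵥ M.point p t = s' +ᵥ M.point p t) : s = s' := by
  obtain ⟨τ, rfl⟩ := QuotientAddGroup.mk_surjective t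
  obtain ⟨σ, rfl⟩ := QuotientAddGroup.mk_surjective s
  obtain ⟨σ', rfl⟩ := QuotientAddGroup.mk_surjective s'
  have h' : M.point p (Torus.mk N (σ + τ)) = M.point p (Torus.mk N (σ' + τ)) := h
  obtain ⟨-, x, c, hc, h'⟩ := M.point_eq_point_iff.1 h'
  rw [P.facetsAt_eq_empty hp] at hc
  have hc0 : c = 0 := funext fun i => hc i (Set.notMem_empty i)
  rw [hc0, map_zero, add_zero, ← add_assoc, add_left_inj] at h'
  change Torus.mk N σ = Torus.mk N σ'
  rw [h', map_add, mk_incl, zero_add]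

/-! ### The covering -/

theorem map_hat_frame {s : Set (Fin m)} (e : Fin n ≃ s) (a : Fin n → ℝ) :
    RealExt.map M.hatModule.subtype (M.hat.frame e a) = M.frame e a := by
  rw [frame_apply, frame_apply, map_sum]
  exact Finset.sum_congr rfl fun k _ => RealExt.map_tmul _ _ _

/-- In the frames given by the same characteristic vectors, the map induced by the inclusion is the
identity matrix. -/
theorem map_hat_eq (hv : v ∈ P.vertices) (e : Fin n ≃ P.facetsAt v) (τ : RealExt M.hatModule) :
    RealExt.map M.hatModule.subtype τ = M.frameEquiv hv e ((M.hat.frameEquiv hv e).symm τ) := by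
  obtain ⟨a, rfl⟩ := M.hat.frame_surjective hv e τ
  rw [map_hat_frame, ← M.hat.frameEquiv_apply hv, LinearEquiv.symm_apply_apply, frameEquiv_apply]

theorem map_hat_bijective : Function.Bijective (RealExt.map M.hatModule.subtype) := by
  obtain ⟨v, hv⟩ := P.vertices_nonempty
  obtain ⟨e⟩ := P.exists_enum hv
  rw [show (RealExt.map M.hatModule.subtype : RealExt M.hatModule → RealExt N) =
    M.frameEquiv hv e ∘ (M.hat.frameEquiv hv e).symm from funext (M.map_hat_eq hv e)]
  exact (M.frameEquiv hv e).bijective.comp (M.hat.frameEquiv hv e).symm.bijective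

theorem continuous_map_hat : Continuous (RealExt.map M.hatModule.subtype) := by
  obtain ⟨v, hv⟩ := P.vertices_nonempty
  obtain ⟨e⟩ := P.exists_enum hv
  rw [show (RealExt.map M.hatModule.subtype : RealExt M.hatModule → RealExt N) =
    M.frameEquiv hv e ∘ (M.hat.frameEquiv hv e).symm from funext (M.map_hat_eq hv e)]
  exact (M.continuous_frame e).comp (M.hat.continuous_frameEquiv_symm hv e)

theorem coverMap_point (p : P.carrier) (τ : RealExt M.hatModule) :
    M.coverMap (M.hat.point p (Torus.mk _ τ)) =
      M.point p (Torus.mk N (RealExt.map M.hatModule.subtype τ)) := rfl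

theorem continuous_coverMap : Continuous M.coverMap := by
  refine M.hat.isQuotientMap_proj.continuous_iff.2 ?_
  exact M.isQuotientMap_proj.continuous.comp
    (continuous_fst.prodMk (M.continuous_map_hat.comp continuous_snd))

theorem coverMap_surjective : Function.Surjective M.coverMap := by
  intro x
  obtain ⟨p, τ, rfl⟩ := M.point_surjective x
  obtain ⟨σ, rfl⟩ := M.map_hat_bijective.2 τ
  exact ⟨_, M.coverMap_point p σ⟩

theorem coverMap_vadd (t : Torus M.hatModule) (x : M.hat.Space) :
    M.coverMap (t +ᵥ x) = Torus.map M.hatModule.subtype t +ᵥ M.coverMap x := by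
  obtain ⟨⟨p, s⟩, rfl⟩ := Quotient.exists_rep x
  change M.point p (Torus.map _ (t + s)) = M.point p (Torus.map _ t + Torus.map _ s)
  rw [map_add]

theorem base_coverMap (x : M.hat.Space) : M.base (M.coverMap x) = M.hat.base x := by
  obtain ⟨p, τ, rfl⟩ := M.hat.point_surjective x
  rfl

theorem coverMap_chart (e : Fin n ≃ P.facetsAt v) (z : chartDomain P v e) :
    M.coverMap ((M.hat.chart v e).toFun z) = (M.chart v e).toFun z := by
  rw [M.chart_toFun, M.hat.chart_toFun, coverMap_point, map_hat_frame]

theorem preimage_chart_range (hv : v ∈ P.vertices) (e : Fin n ≃ P.facetsAt v) :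
    M.coverMap ⁻¹' Set.range (M.chart v e).toFun = Set.range (M.hat.chart v e).toFun := by
  rw [M.chart_range hv e, M.hat.chart_range hv e]
  ext x
  rw [Set.mem_preimage, Set.mem_ofPred_eq, base_coverMap]
  rfl

theorem hat_chartGroup_le (e : Fin n ≃ P.facetsAt v) : M.hat.chartGroup e ≤ M.chartGroup e := by
  intro g hg
  obtain ⟨a, ha, rfl⟩ := (M.hat.mem_chartGroup_iff e).1 hg
  refine (M.mem_chartGroup_iff e).2 ⟨a, ?_, rfl⟩
  rw [← map_hat_frame]
  exact (congrArg (Torus.map M.hatModule.subtype) ha).trans (map_zero _)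

/-- The two charts at `v` have the same domain and `f` lifts to the identity. The preimage of the
chart image is the image of a connected set, so it is its own single component. -/
theorem isOrbifoldCovering_coverMap : IsOrbifoldCovering M.hat.atlas M.atlas M.coverMap where
  smooth := by
    refine ⟨M.continuous_coverMap, fun y => ?_⟩
    obtain ⟨v, hv, e, -, hy⟩ := M.hat.exists_mem_chart_range y
    refine ⟨_, M.hat.chart_mem_maximal hv e, _, M.chart_mem_maximal hv e, hy, ?_, id,
      IsSmoothMap.id, fun z => (M.coverMap_chart e z).symm⟩
    rwa [← M.preimage_chart_range hv e] at hy
  locally_quotient x := by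
    obtain ⟨v, hv, e, -, hx⟩ := M.exists_mem_chart_range x
    refine ⟨_, M.chart_mem_maximal hv e, hx, fun y hy => ?_⟩
    refine ⟨M.hat.chartGroup e, (M.hat.chart v e).toFun, M.hat_chartGroup_le e,
      M.hat.chart_mem_maximal hv e, ?_, M.coverMap_chart e⟩
    rw [M.preimage_chart_range hv e] at hy ⊢
    have hc := M.hat.isOrbifoldChart_chart hv e
    have : ConnectedSpace (M.hat.chart v e).domain :=
      isConnected_iff_connectedSpace.1 hc.isConnected_domain
    exact ((isPreconnected_range hc.continuous_toFun).connectedComponentIn hy).symm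

/-! ### The deck transformations -/

/-- The homomorphism `N → T_N̂` given by `N ⊆ N_ℝ = N̂_ℝ`. -/
def toHatTorus : N →+ Torus M.hatModule :=
  (Torus.mk M.hatModule).comp
    ((AddEquiv.ofBijective _ M.map_hat_bijective).symm.toAddMonoidHom.comp (RealExt.incl N))

theorem toHatTorus_eq {ν : N} {b : RealExt M.hatModule}
    (h : RealExt.map M.hatModule.subtype b = RealExt.incl N ν) :
    M.toHatTorus ν = Torus.mk M.hatModule b := by
  change Torus.mk _ ((AddEquiv.ofBijective _ M.map_hat_bijective).symm (RealExt.incl N ν)) = _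
  congr 1
  rw [AddEquiv.symm_apply_eq]
  exact h.symm

theorem toHatTorus_eq_zero_iff {ν : N} : M.toHatTorus ν = 0 ↔ ν ∈ M.hatModule := by
  have := M.free
  obtain ⟨b, hb⟩ := M.map_hat_bijective.2 (RealExt.incl N ν)
  rw [M.toHatTorus_eq hb, mk_eq_zero_iff]
  constructor
  · rintro ⟨x, rfl⟩
    rw [RealExt.map_incl] at hb
    rw [← RealExt.incl_injective hb]
    exact x.2
  · intro hν
    refine ⟨⟨ν, hν⟩, M.map_hat_bijective.1 ?_⟩
    rw [RealExt.map_incl, hb]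
    rfl

theorem map_toHatTorus (ν : N) : Torus.map M.hatModule.subtype (M.toHatTorus ν) = 0 := by
  obtain ⟨b, hb⟩ := M.map_hat_bijective.2 (RealExt.incl N ν)
  rw [M.toHatTorus_eq hb]
  change Torus.mk N (RealExt.map _ b) = 0
  rw [hb, mk_incl]

/-- The injection of `N / N̂` into `T_N̂`. -/
def quotientToHatTorus : (N ⧸ M.hatModule) →ₗ[ℤ] Torus M.hatModule :=
  M.hatModule.liftQ M.toHatTorus.toIntLinearMap fun _ hν => M.toHatTorus_eq_zero_iff.2 hν

theorem quotientToHatTorus_mk (ν : N) :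
    M.quotientToHatTorus (Submodule.Quotient.mk ν) = M.toHatTorus ν := rfl

theorem quotientToHatTorus_injective : Function.Injective M.quotientToHatTorus := by
  rw [injective_iff_map_eq_zero]
  intro q hq
  obtain ⟨ν, rfl⟩ := Submodule.Quotient.mk_surjective _ q
  exact (Submodule.Quotient.mk_eq_zero _).2 (M.toHatTorus_eq_zero_iff.1 hq)

/-- The action of `N / N̂` by translations. -/
def deck : Multiplicative (N ⧸ M.hatModule) →* (M.hat.Space ≃ₜ M.hat.Space) where
  toFun q := M.hat.translation (M.quotientToHatTorus q.toAdd)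
  map_one' := by
    ext x
    change M.quotientToHatTorus 0 +ᵥ x = x
    rw [map_zero, zero_vadd]
  map_mul' q r := by
    ext x
    change M.quotientToHatTorus (q.toAdd + r.toAdd) +ᵥ x =
      M.quotientToHatTorus q.toAdd +ᵥ (M.quotientToHatTorus r.toAdd +ᵥ x)
    rw [map_add, add_vadd]

theorem deck_apply (q : N ⧸ M.hatModule) (x : M.hat.Space) :
    M.deck (Multiplicative.ofAdd q) x = M.quotientToHatTorus q +ᵥ x := rfl

theorem deck_injective : Function.Injective M.deck := by
  intro q r h
  obtain ⟨p, hp⟩ := P.inner_nonempty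
  have := DFunLike.congr_fun h (M.hat.point ⟨p, P.inner_subset hp⟩ 0)
  exact M.quotientToHatTorus_injective (M.hat.vadd_right_cancel_of_inner hp this)

theorem isDeckTransformation_deck (q : N ⧸ M.hatModule) :
    IsDeckTransformation M.hat.atlas M.coverMap (M.deck (Multiplicative.ofAdd q)) := by
  refine ⟨M.hat.isOrbifoldSmooth_vadd _, M.hat.isOrbifoldSmooth_vadd _, funext fun x => ?_⟩
  obtain ⟨ν, rfl⟩ := Submodule.Quotient.mk_surjective _ q
  rw [Function.comp_apply, deck_apply, coverMap_vadd, quotientToHatTorus_mk, map_toHatTorus,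
    zero_vadd]

/-- With no facet through `p`, the relation in `X` leaves only a lattice vector `ν`, whose class
modulo `N̂` is the required `q`. -/
theorem exists_vadd_eq_of_coverMap_eq {p : P.carrier}
    (hp : (p : EuclideanSpace ℝ (Fin n)) ∈ P.inner) {τ : RealExt M.hatModule} {y : M.hat.Space}
    (h : M.coverMap y = M.coverMap (M.hat.point p (Torus.mk _ τ))) :
    ∃ q, y = M.quotientToHatTorus q +ᵥ M.hat.point p (Torus.mk _ τ) := by
  obtain ⟨p', σ, rfl⟩ := M.hat.point_surjective y
  rw [coverMap_point, coverMap_point, point_eq_point_iff] at h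
  obtain ⟨rfl, ν, c, hc, h⟩ := h
  rw [P.facetsAt_eq_empty hp] at hc
  have hc0 : c = 0 := funext fun i => hc i (Set.notMem_empty i)
  rw [hc0, map_zero, add_zero, ← sub_eq_iff_eq_add, ← map_sub] at h
  refine ⟨Submodule.Quotient.mk ν, ?_⟩
  rw [quotientToHatTorus_mk, M.toHatTorus_eq h, vadd_point, ← map_add, sub_add_cancel]

theorem exists_deck_eq {h : M.hat.Space ≃ₜ M.hat.Space} (hh : M.coverMap ∘ h = M.coverMap) :
    ∃ q, M.deck (Multiplicative.ofAdd q) = h := by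
  obtain ⟨v, hv⟩ := P.vertices_nonempty
  obtain ⟨e⟩ := P.exists_enum hv
  have := M.hat.t2Space
  have : Finite (N ⧸ M.hatModule) := by
    have := M.free
    have := M.finite
    exact Submodule.finiteQuotientOfFreeOfRankEq _ (M.hat.finrank_eq.trans M.finrank_eq.symm)
  -- The part of `O` over the interior is parametrized by a connected space, and its image is dense
  -- because the interior is dense in `P`.
  let π : P.inner × (Fin n → ℝ) → M.hat.Space :=
    M.hat.proj ∘ Prod.map (Set.inclusion P.inner_subset) (M.hat.frame e)
  have hπ : Continuous π := M.hat.isQuotientMap_proj.continuous.comp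
    ((continuous_inclusion _).prodMap (M.hat.continuous_frame e))
  have hdense : DenseRange π := M.hat.isQuotientMap_proj.surjective.denseRange.comp
    (((denseRange_inclusion_iff P.inner_subset).2 P.carrier_subset_closure_inner).prodMap
      (M.hat.frame_surjective hv e).denseRange) M.hat.isQuotientMap_proj.continuous
  have hex : ∀ z, ∃ q, h (π z) = M.quotientToHatTorus q +ᵥ π z := fun z =>
    M.exists_vadd_eq_of_coverMap_eq z.1.2 (congrFun hh (π z))
  choose c hc using hex
  have huniq : ∀ z q, h (π z) = M.quotientToHatTorus q +ᵥ π z → c z = q := fun z q hq =>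
    M.quotientToHatTorus_injective
      (M.hat.vadd_right_cancel_of_inner z.1.2 ((hc z).symm.trans hq))
  -- Each fibre of `c` is an equalizer of continuous maps into a Hausdorff space, and there are
  -- finitely many. So all preimages are closed, hence also open.
  have hclosed : ∀ s : Set (N ⧸ M.hatModule), IsClosed (c ⁻¹' s) := by
    intro s
    have : c ⁻¹' s = ⋃ q ∈ s, {z | h (π z) = M.quotientToHatTorus q +ᵥ π z} := by
      ext z
      simp only [Set.mem_preimage, Set.mem_iUnion, Set.mem_ofPred_eq, exists_prop]
      constructor
      · intro hz
        exact ⟨c z, hz, hc z⟩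
      · rintro ⟨q, hq, hz⟩
        rwa [huniq z q hz]
    rw [this]
    exact s.toFinite.isClosed_biUnion fun q _ =>
      isClosed_eq (h.continuous.comp hπ) ((M.hat.continuous_vadd _).comp hπ)
  have hloc : IsLocallyConstant c := fun s => by
    rw [← isClosed_compl_iff, ← Set.preimage_compl]
    exact hclosed sᶜ
  have : PreconnectedSpace P.inner :=
    isPreconnected_iff_preconnectedSpace.1 P.inner_convex.isPreconnected
  obtain ⟨p, hp⟩ := P.inner_nonempty
  let z₀ : P.inner × (Fin n → ℝ) := (⟨p, hp⟩, 0)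
  refine ⟨c z₀, ?_⟩
  have hfun := hdense.equalizer (M.hat.continuous_vadd (M.quotientToHatTorus (c z₀))) h.continuous
    (funext fun z => by
      rw [Function.comp_apply, Function.comp_apply, hc z, hloc.apply_eq_of_preconnectedSpace z z₀])
  exact Homeomorph.ext fun x => congrFun hfun x

end CombinatorialModel

end

/-! ### The proposition. -/

theorem proposition3p1 {n m : ℕ} (P : SimplePolytope n m) {N : Type*} [AddCommGroup N]
    (M : CombinatorialModel P N) :
    IsOrbifoldAtlas M.atlas ∧ IsOrbifoldAtlas M.hat.atlas ∧
    (∀ (t : Torus M.hatModule) (x : M.hat.Space),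
      M.coverMap (t +ᵥ x) = Torus.map M.hatModule.subtype t +ᵥ M.coverMap x) ∧
    Function.Surjective M.coverMap ∧
    IsOrbifoldCovering M.hat.atlas M.atlas M.coverMap ∧
    ∃ Φ : Multiplicative (N ⧸ M.hatModule) →* (M.hat.Space ≃ₜ M.hat.Space),
      Function.Injective Φ ∧
      Set.range Φ = {h | IsDeckTransformation M.hat.atlas M.coverMap h} ∧
      ∀ (ν : N) (b : RealExt M.hatModule),
        RealExt.map M.hatModule.subtype b = RealExt.incl N ν →
        ∀ x : M.hat.Space,
          Φ (Multiplicative.ofAdd (Submodule.Quotient.mk ν)) x = Torus.mk M.hatModule b +ᵥ x := by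
  refine ⟨M.isOrbifoldAtlas_atlas, M.hat.isOrbifoldAtlas_atlas, M.coverMap_vadd,
    M.coverMap_surjective, M.isOrbifoldCovering_coverMap, M.deck, M.deck_injective, ?_, ?_⟩
  · ext h
    constructor
    · rintro ⟨q, rfl⟩
      exact M.isDeckTransformation_deck q.toAdd
    · rintro ⟨-, -, hh⟩
      obtain ⟨q, rfl⟩ := M.exists_deck_eq hh
      exact ⟨_, rfl⟩
  · intro ν b hb x
    rw [M.deck_apply, M.quotientToHatTorus_mk, M.toHatTorus_eq hb]
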